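/- A hypergraph $H$ has a finite vertex set $V(H)$ and a set $E(H)$ of nonempty subsets of $V(H)$; every vertex lies in some edge. Vertices are adjacent if some edge contains both. $\mathrm{rank}(H)$ is the maximum size of an edge, $\Delta(H)$ the maximum number of edges containing a common vertex, and $H[U]$ has vertex set $U$ and edges the nonempty sets $U\cap e$, $e\in E(H)$. A width function $f$ assigns a real $f_H(U)\ge 0$ to each hypergraph $H$ and $U\subseteq V(H)$. The $f$-width of a tree decomposition of $H$ is the maximum of $f_H$ over its bags, and $f\text{-width}(H)$ is the minimum $f$-width of a tree decomposition of $H$. Let $f$ be a width function such that * (weak additivity) $f_H(U_1\cup U_2)=f_H(U_1)+f_H(U_2)$ whenever $U_1,U_2\subseteq V(H)$ are disjoint and no edge meets both; * (bounded size) there is a function $\beta$ such that $f_H(U)\le k$ implies $|U|\le\beta(k,\mathrm{rank}(H))$ for all $H$, $U\subseteq V(H)$ and $k\ge 0$; * (invariant locality) $f_{H_1}(U_1)=f_{H_2}(U_2)$ whenever $H_1[U_1]$ and $H_2[U_2]$ are isomorphic. (Every manageable width function has these properties; manageability additionally requires computability conditions, which are not needed.) An elimination forest of $H$ is a rooted forest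 $F$ on $V(H)$ in which any two vertices of a common edge are comparable in the ancestor order (every vertex is an ancestor and a descendant of itself). $F_v$ is the set of descendants of $v$. The set $\mathrm{bag}_F(u)$ consists of $u$ and all ancestors of $u$ adjacent to some vertex of $F_u$; the $f$-width of $F$ is $\max_u f_H(\mathrm{bag}_F(u))$. $F$ is reduced if every vertex $u$ is adjacent to some vertex of $F_v$, for each child $v$ of $u$. A context factor of $F$ is a set $U=F_r\setminus\bigcup_{w\in W}F_w$, where $W\neq\emptyset$ is a set of children of a single descendant $p$ of $r$; its spine is the path of $F$ from $r$ to $p$. Given a partition $(Red,X,Blue)$ of $V(H)$, parts possibly empty, such that no edge meets both $Red$ and $Blue$, and a context factor $U\subseteq Red\cup Blue$ of $F$, the (colour) intervals of $U$ are the maximal subpaths $P_1,\dots,P_q$ of its spine contained in $Red$ or in $Blue$, listed from the root. For $1<i<q-1$, let $(u_1,u_2)$, $(v_1,v_2)$, $(w_1,w_2)$ be the edges of $F$ from the last vertex of $P_{i-1}$, $P_i$, $P_{i+1}$ to the first vertex of $P_i$, $P_{i+1}$, $P_{i+2}$, respectively. The swap of $P_i$ and $P_{i+1}$ is the forest $F'$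 obtained from $F$ by removing these three edges and adding $(u_1,v_2)$, $(w_1,u_2)$, $(v_1,w_2)$. $U$ admits a neutral swap if, for some such $i$, $F'$ is an elimination forest of $H$ whose $f$-width is at most that of $F$. **Lemma.** For every $f$ as above there is a function $\kappa$ with values in $\mathbb N$, monotone in its four arguments, such that the following holds for every hypergraph $H$ and every partition $(Red,X,Blue)$ of $V(H)$ in which no edge meets both $Red$ and $Blue$. Let $F$ be a reduced elimination forest of $H$ whose $f$-width equals $f\text{-width}(H)$, and let $U\subseteq Red\cup Blue$ be a context factor of $F$ with more than $\kappa(|X|,f\text{-width}(H),\mathrm{rank}(H),\Delta(H))$ colour intervals. Then $U$ admits a neutral swap. -/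

import Mathlib

open scoped NNReal

universe u

namespace HWidth

/-! ### Hypergraphs -/

/-- The standing conventions on hypergraphs: the vertex set is finite, edges are nonempty, and
every vertex lies in some edge. -/
structure Proper {α : Type u} (H : Hypergraph α) : Prop where
  finite : H.vertexSet.Finite
  edge_nonempty : ∀ e ∈ H.edgeSet, e.Nonempty
  not_isolated : ∀ v ∈ H.vertexSet, ¬ H.IsIsolated v

/-- `rank(H)`, the maximum size of an edge. -/
noncomputable def rank {α : Type u} (H : Hypergraph α) : ℕ :=
  sSup {n | ∃ e ∈ H.edgeSet, n = e.ncard}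

/-- `Δ(H)`, the maximum number of edges that contain a common vertex. -/
noncomputable def maxDegree {α : Type u} (H : Hypergraph α) : ℕ :=
  sSup {n | ∃ v ∈ H.vertexSet, n = {e ∈ H.edgeSet | v ∈ e}.ncard}

/-- `H[U]`: the vertex set is `U` and the edges are the nonempty traces on `U` of edges of `H`. -/
def induce {α : Type u} (H : Hypergraph α) (U : Set α) : Hypergraph α where
  vertexSet := U
  edgeSet := {s | s.Nonempty ∧ ∃ e ∈ H.edgeSet, s = U ∩ e}
  subset_vertexSet_of_mem_edgeSet' := by
    rintro s ⟨-, e, -, rfl⟩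
    exact Set.inter_subset_left

/-- Isomorphism of hypergraphs: a bijection of the vertex sets that preserves and reflects
being an edge. -/
def Isomorphic {α β : Type u} (H : Hypergraph α) (K : Hypergraph β) : Prop :=
  ∃ φ : H.vertexSet ≃ K.vertexSet, ∀ s : Set H.vertexSet,
    (Subtype.val '' s) ∈ H.edgeSet ↔ (Subtype.val '' (φ '' s)) ∈ K.edgeSet

/-! ### Width functions -/

/-- A width function assigns a nonnegative real `f H U` to a hypergraph `H` and a set `U` of
vertices of `H` (values at other pairs are never used). -/
abbrev WidthFunction : Type (u + 1) :=
  ∀ ⦃α : Type u⦄, Hypergraph α → Set α → ℝ≥0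

/-- The combinatorial conditions on a manageable width function. Manageability in addition asks
that the size bound `β` be computable and that `f H V(H)` can be computed from `H`; those two
requirements are not imposed here, so that the class below contains every manageable function. -/
structure WeaklyManageable (f : WidthFunction.{u}) : Prop where
  weak_additivity : ∀ ⦃α : Type u⦄ (H : Hypergraph α), Proper H →
    ∀ U₁ ⊆ H.vertexSet, ∀ U₂ ⊆ H.vertexSet, Disjoint U₁ U₂ →
      (∀ x ∈ U₁, ∀ y ∈ U₂, ¬ H.Adj x y) → f H (U₁ ∪ U₂) = f H U₁ + f H U₂
  bounded_size : ∃ β : ℝ≥0 → ℕ → ℕ, ∀ (k : ℝ≥0) ⦃α : Type u⦄ (H : Hypergraph α), Proper H →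
    ∀ U ⊆ H.vertexSet, f H U ≤ k → U.ncard ≤ β k (rank H)
  invariant_locality : ∀ ⦃α β : Type u⦄ (H : Hypergraph α) (K : Hypergraph β),
    Proper H → Proper K → ∀ U ⊆ H.vertexSet, ∀ W ⊆ K.vertexSet,
      Isomorphic (induce H U) (induce K W) → f H U = f K W

/-! ### Tree decompositions -/

/-- A tree decomposition of `H` with set of nodes `ι`. -/
structure TreeDecomposition {α : Type u} (H : Hypergraph α) (ι : Type) where
  tree : SimpleGraph ι
  isTree : tree.IsTree
  bag : ι → Set α
  bag_subset : ∀ n, bag n ⊆ H.vertexSet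
  edge_covered : ∀ e ∈ H.edgeSet, ∃ n, e ⊆ bag n
  connected : ∀ v ∈ H.vertexSet, (tree.induce {n | v ∈ bag n}).Connected

/-- The `f`-width of a tree decomposition: the largest width of a bag. -/
noncomputable def TreeDecomposition.width {α : Type u} {H : Hypergraph α} {ι : Type}
    (t : TreeDecomposition H ι) (f : WidthFunction.{u}) : ℝ≥0 :=
  ⨆ n, f H (t.bag n)

/-- The `f`-width of `H`: the least `f`-width of a (finite) tree decomposition of `H`. -/
noncomputable def fwidth (f : WidthFunction.{u}) {α : Type u} (H : Hypergraph α) : ℝ≥0 :=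
  sInf {w | ∃ (n : ℕ) (t : TreeDecomposition H (Fin n)), t.width f = w}

/-! ### Rooted forests and elimination forests -/

/-- A rooted forest with vertex set `S`, given by its parent function (`none` at roots). -/
structure RootedForest {α : Type u} (S : Set α) where
  parent : α → Option α
  mem_of_parent : ∀ u v, parent v = some u → u ∈ S ∧ v ∈ S
  acyclic : WellFounded fun u v => parent v = some u

namespace RootedForest

variable {α : Type u} {S : Set α}

/-- The edges of the forest as pairs (parent, child). -/
def edges (F : RootedForest S) : Set (α × α) := {a | F.parent a.2 = some a.1}

/-- `u` is an ancestor of `v`, equivalently `v` is a descendant of `u`; every vertex is an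
ancestor of itself. -/
def Anc (F : RootedForest S) (u v : α) : Prop :=
  Relation.ReflTransGen (fun a b => F.parent b = some a) u v

/-- The tree factor `V(F_x)`: all descendants of `x`. -/
def treeFactor (F : RootedForest S) (x : α) : Set α := {v | F.Anc x v}

/-- A context factor: a tree factor minus the forest factor whose roots, the appendices, are
siblings (with common parent `pr`) and strict descendants of the root `rt`. -/
structure ContextFactor (F : RootedForest S) where
  rt : α
  pr : α
  appendices : Set α
  appendices_nonempty : appendices.Nonempty
  parent_appendices : ∀ w ∈ appendices, F.parent w = some pr
  anc_rt_pr : F.Anc rt pr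

/-- The vertex set of a context factor. -/
def ContextFactor.carrier {F : RootedForest S} (U : F.ContextFactor) : Set α :=
  F.treeFactor U.rt \ ⋃ w ∈ U.appendices, F.treeFactor w

/-- The vertex set of the path from the root to the parent of the appendices. -/
def ContextFactor.spine {F : RootedForest S} (U : F.ContextFactor) : Set α :=
  {v | F.Anc U.rt v ∧ F.Anc v U.pr}

/-- `Q` is the vertex set of a subpath of the directed path with vertex set `P`. -/
def IsSubpath (F : RootedForest S) (P Q : Set α) : Prop :=
  Q ⊆ P ∧ Q.Nonempty ∧
    ∀ a ∈ Q, ∀ b ∈ Q, ∀ c ∈ P, F.Anc a c → F.Anc c b → c ∈ Q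

/-- `a` is the first vertex (the one closest to the root) of the directed path `Q`. -/
def IsFirst (F : RootedForest S) (Q : Set α) (a : α) : Prop := a ∈ Q ∧ ∀ b ∈ Q, F.Anc a b

/-- `a` is the last vertex of the directed path `Q`. -/
def IsLast (F : RootedForest S) (Q : Set α) (a : α) : Prop := a ∈ Q ∧ ∀ b ∈ Q, F.Anc b a

end RootedForest

/-- An elimination forest of `H`: a rooted forest on `V(H)` in which any two vertices of a common
edge are comparable. -/
structure ElimForest {α : Type u} (H : Hypergraph α) extends RootedForest H.vertexSet where
  comparable : ∀ e ∈ H.edgeSet, ∀ u ∈ e, ∀ v ∈ e,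
    toRootedForest.Anc u v ∨ toRootedForest.Anc v u

namespace ElimForest

variable {α : Type u} {H : Hypergraph α}

/-- `bag_F(u)`: `u` together with all ancestors of `u` that are adjacent to `u` or to a
descendant of `u`. -/
def bag (F : ElimForest H) (u : α) : Set α :=
  {v | v = u ∨ (F.Anc v u ∧ v ≠ u ∧ ∃ w, F.Anc u w ∧ H.Adj v w)}

/-- The `f`-width of an elimination forest: the largest width of a bag. -/
noncomputable def width (F : ElimForest H) (f : WidthFunction.{u}) : ℝ≥0 :=
  ⨆ u : H.vertexSet, f H (F.bag u)

/-- `F` is reduced: every vertex `u` is adjacent to the subtree of each of its children `v`. -/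
def Reduced (F : ElimForest H) : Prop :=
  ∀ u v, F.parent v = some u → ∃ w ∈ F.treeFactor v, H.Adj u w

end ElimForest

/-! ### Colours, intervals and swaps -/

/-- A partition `(Red, X, Blue)` of `V(H)`, parts possibly empty, such that no edge contains both
a red and a blue vertex. -/
structure ColourPartition {α : Type u} (H : Hypergraph α) where
  red : Set α
  X : Set α
  blue : Set α
  union_eq : red ∪ X ∪ blue = H.vertexSet
  disjoint_red_X : Disjoint red X
  disjoint_red_blue : Disjoint red blue
  disjoint_X_blue : Disjoint X blue
  no_mixed_edge : ∀ e ∈ H.edgeSet, ¬ ((e ∩ red).Nonempty ∧ (e ∩ blue).Nonempty)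

/-- A set is monochromatic if it is all red or all blue. -/
def ColourPartition.Monochromatic {α : Type u} {H : Hypergraph α} (C : ColourPartition H)
    (Q : Set α) : Prop :=
  Q ⊆ C.red ∨ Q ⊆ C.blue

/-- The colour intervals of a context factor: the maximal monochromatic subpaths of its spine. -/
def intervals {α : Type u} {H : Hypergraph α} (C : ColourPartition H)
    {F : RootedForest H.vertexSet} (U : F.ContextFactor) : Set (Set α) :=
  {Q | Maximal (fun Q => F.IsSubpath U.spine Q ∧ C.Monochromatic Q) Q}

/-- `F'` is the swap of `F` in which the consecutive intervals `P₂`, `P₃` of `U` are swapped: there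
are four consecutive intervals `P₁, P₂, P₃, P₄` of `U`, joined by the edges `(u₁, u₂)`, `(v₁, v₂)`,
`(w₁, w₂)` of `F`, and `F'` arises from `F` by removing these three edges and adding `(u₁, v₂)`,
`(w₁, u₂)`, `(v₁, w₂)`. -/
def IsSwap {α : Type u} {H : Hypergraph α} (C : ColourPartition H)
    {F : RootedForest H.vertexSet} (U : F.ContextFactor) (P₂ P₃ : Set α)
    (F' : RootedForest H.vertexSet) : Prop :=
  ∃ P₁ ∈ intervals C U, P₂ ∈ intervals C U ∧ P₃ ∈ intervals C U ∧ ∃ P₄ ∈ intervals C U,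
    ∃ u₁ u₂ v₁ v₂ w₁ w₂ : α,
      F.IsLast P₁ u₁ ∧ F.IsFirst P₂ u₂ ∧ (u₁, u₂) ∈ F.edges ∧
      F.IsLast P₂ v₁ ∧ F.IsFirst P₃ v₂ ∧ (v₁, v₂) ∈ F.edges ∧
      F.IsLast P₃ w₁ ∧ F.IsFirst P₄ w₂ ∧ (w₁, w₂) ∈ F.edges ∧
      F'.edges = (F.edges \ {(u₁, u₂), (v₁, v₂), (w₁, w₂)}) ∪ {(u₁, v₂), (w₁, u₂), (v₁, w₂)}

/-- `U` admits a neutral swap: some swap of two consecutive intervals of `U` is again an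
elimination forest of `H`, and its `f`-width does not exceed that of `F`. -/
def AdmitsNeutralSwap (f : WidthFunction.{u}) {α : Type u} {H : Hypergraph α}
    (C : ColourPartition H) (F : ElimForest H) (U : F.ContextFactor) : Prop :=
  ∃ (P₂ P₃ : Set α) (F' : ElimForest H),
    IsSwap C U P₂ P₃ F'.toRootedForest ∧ F'.width f ≤ F.width f

end HWidth

/-! ### Ancestor order and the exchange of two vertical paths. -/

namespace HWidth

namespace RootedForest

variable {α : Type u} {S : Set α} {F : RootedForest S}

/-! Each colour change on the spine is an edge $(x,y)$ of $F$ with a separator `F.cut x y`. This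
separator lies in the bag of $y$, so it has at most $N$ vertices, where $N$ bounds the bag sizes of
the optimal forest $F$. As $F$ is reduced, a subtree hanging off the spine inside $U$ has the colour
of its attachment vertex. Hence the whole zone of $U$ between two successive changes is
monochromatic (`red_iff_of_between`).

Exchange two successive zones, say red above blue, with separators $a$ above, $b$ between and $c$
below them. No edge joins the zones, so adjacent vertices stay comparable, and only the bags on the
two spine pieces can change. If $a,b,c$ have the same trace on $X$, a bag on the upper piece keeps
its red part and its $X$ part, while its blue part changes from that of $b$ to that of $c$; moreover
$b$ and $c$ have the same red part. On the lower piece the red part of $b$ is replaced by that of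
$a$ (`swap_cut_upper`, `swap_cut_lower`).

Suppose moreover that $a,b,c$ agree on the ball of radius $N+1$ around $X$. Among the first $N+1$
layers around $X$, one misses the changing part before and after the change, and what lies beyond it
contributes additively. So the effect of the replacement on the width is independent of the part in
the other colour (`exchange`). It equals $f(c)-f(b)$ on the upper piece and $f(a)-f(b)$ on the lower
one, so the swap is neutral as soon as $f(b)\ge f(a),f(c)$.

Such a triple comes from two pigeonhole arguments. A vertex occurs in the separators of an interval
of changes, so the traces on the ball change at most twice per vertex of the ball, and a long
sequence has a long block with constant trace (`exists_constant_block`). By invariant locality, sets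
of at most $N$ vertices have boundedly many widths, so that block has a weak local maximum
(`exists_local_max`). -/

theorem Anc.rfl {x : α} : F.Anc x x := Relation.ReflTransGen.refl

theorem Anc.trans {x y z : α} (h : F.Anc x y) (h' : F.Anc y z) : F.Anc x z :=
  Relation.ReflTransGen.trans h h'

theorem anc_of_parent {x y : α} (h : F.parent y = some x) : F.Anc x y :=
  Relation.ReflTransGen.single h

theorem Anc.of_parent {x y z : α} (h : F.Anc x y) (hz : F.parent z = some y) : F.Anc x z :=
  Relation.ReflTransGen.tail h hz

/-- A strict ancestor of a vertex is an ancestor of its parent. -/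
theorem Anc.anc_parent {x y z : α} (h : F.Anc x y) (hne : x ≠ y) (hy : F.parent y = some z) :
    F.Anc x z := by
  rcases Relation.ReflTransGen.cases_tail h with h | ⟨c, hc, hcy⟩
  · exact absurd h.symm hne
  · rw [hy] at hcy
    obtain rfl := Option.some.inj hcy
    exact hc

theorem Anc.not_of_parent {x y : α} (h : F.parent y = some x) : ¬ F.Anc y x := by
  intro hyx
  exact F.acyclic.transGen.irrefl.irrefl x (Relation.TransGen.head' h hyx)

theorem Anc.antisymm {x y : α} (h : F.Anc x y) (h' : F.Anc y x) : x = y := by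
  rcases Relation.ReflTransGen.cases_tail h with h | ⟨c, hc, hcy⟩
  · exact h.symm
  · exact absurd (Anc.trans h' hc) (Anc.not_of_parent hcy)

/-- The ancestors of a vertex form a chain. -/
theorem Anc.total {x y z : α} (h : F.Anc x z) (h' : F.Anc y z) : F.Anc x y ∨ F.Anc y x := by
  induction h with
  | refl => exact Or.inr h'
  | @tail b c hb hbc ih =>
    by_cases hy : y = c
    · exact Or.inl (hy ▸ Anc.of_parent hb hbc)
    · exact ih (h'.anc_parent hy hbc)

theorem Anc.mem_right {x y : α} (h : F.Anc x y) (hx : x ∈ S) : y ∈ S := by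
  rcases Relation.ReflTransGen.cases_tail h with h | ⟨c, -, hc⟩
  · exact h ▸ hx
  · exact (F.mem_of_parent _ _ hc).2

/-- Two consecutive vertical paths, from `u₂` to `v₁` and from `v₂` to `w₁`, joined with each other
and with the rest of the forest by the edges `(u₁, u₂)`, `(v₁, v₂)`, `(w₁, w₂)`. -/
structure Consecutive (F : RootedForest S) (u₁ u₂ v₁ v₂ w₁ w₂ : α) : Prop where
  parent_u : F.parent u₂ = some u₁
  parent_v : F.parent v₂ = some v₁
  parent_w : F.parent w₂ = some w₁
  anc_uv : F.Anc u₂ v₁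
  anc_vw : F.Anc v₂ w₁

variable {u₁ u₂ v₁ v₂ w₁ w₂ : α}

open Classical in
/-- The parent function after two consecutive vertical paths have been exchanged. -/
noncomputable def swapParent (F : RootedForest S) (u₁ u₂ v₁ v₂ w₁ w₂ : α) (x : α) : Option α :=
  if x = v₂ then some u₁ else if x = u₂ then some w₁ else if x = w₂ then some v₁ else F.parent x

open Classical in
/-- The position of a vertex with respect to the two vertical paths after their exchange. -/
noncomputable def swapZone (F : RootedForest S) (u₂ v₂ w₂ : α) (x : α) : ℕ :=
  if F.Anc w₂ x then 3 else if F.Anc v₂ x then 1 else if F.Anc u₂ x then 2 else 0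

namespace Consecutive

theorem swapParent_cases {x y : α}
    (hp : F.swapParent u₁ u₂ v₁ v₂ w₁ w₂ y = some x) :
    (y = v₂ ∧ x = u₁) ∨ (y = u₂ ∧ x = w₁) ∨ (y = w₂ ∧ x = v₁) ∨
      (y ≠ v₂ ∧ y ≠ u₂ ∧ y ≠ w₂ ∧ F.parent y = some x) := by
  unfold swapParent at hp
  grind

theorem anc_u_v (h : F.Consecutive u₁ u₂ v₁ v₂ w₁ w₂) : F.Anc u₂ v₂ :=
  h.anc_uv.of_parent h.parent_v

theorem anc_v_w (h : F.Consecutive u₁ u₂ v₁ v₂ w₁ w₂) : F.Anc v₂ w₂ :=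
  h.anc_vw.of_parent h.parent_w

theorem anc_u_w (h : F.Consecutive u₁ u₂ v₁ v₂ w₁ w₂) : F.Anc u₂ w₂ :=
  h.anc_u_v.trans h.anc_v_w

theorem ne_uv (h : F.Consecutive u₁ u₂ v₁ v₂ w₁ w₂) : u₂ ≠ v₂ := by
  rintro rfl; exact Anc.not_of_parent h.parent_v h.anc_uv

theorem ne_vw (h : F.Consecutive u₁ u₂ v₁ v₂ w₁ w₂) : v₂ ≠ w₂ := by
  rintro rfl; exact Anc.not_of_parent h.parent_w h.anc_vw

theorem ne_uw (h : F.Consecutive u₁ u₂ v₁ v₂ w₁ w₂) : u₂ ≠ w₂ := by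
  rintro rfl; exact Anc.not_of_parent h.parent_w (h.anc_u_v.trans h.anc_vw)

/-- `swapZone` numbers the zones in the order in which the new forest meets them, so new edges raise
the number and surviving edges keep it. The lexicographic order then yields acyclicity of the new
forest. -/
theorem zone_lt_or_parent (h : F.Consecutive u₁ u₂ v₁ v₂ w₁ w₂) {x y : α}
    (hp : F.swapParent u₁ u₂ v₁ v₂ w₁ w₂ y = some x) :
    F.swapZone u₂ v₂ w₂ x < F.swapZone u₂ v₂ w₂ y ∨
      (F.swapZone u₂ v₂ w₂ x = F.swapZone u₂ v₂ w₂ y ∧ F.parent y = some x) := by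
  have n1 := Anc.not_of_parent h.parent_u
  have n2 := Anc.not_of_parent h.parent_v
  have n3 := Anc.not_of_parent h.parent_w
  have n4 : ¬ F.Anc v₂ u₂ := fun h' => n2 (h'.trans h.anc_uv)
  have n5 : ¬ F.Anc w₂ v₂ := fun h' => n3 (h'.trans h.anc_vw)
  have n6 : ¬ F.Anc w₂ v₁ := fun h' => n2 (h.anc_v_w.trans h')
  have n7 : ¬ F.Anc w₂ u₂ := fun h' => n4 (h.anc_v_w.trans h')
  have n8 : ¬ F.Anc v₂ u₁ := fun h' => n1 (h.anc_u_v.trans h')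
  have n9 : ¬ F.Anc w₂ u₁ := fun h' => n1 (h.anc_u_w.trans h')
  have a1 := h.anc_vw
  have a2 := h.anc_uv
  have a3 : F.Anc w₂ w₂ := Anc.rfl
  have a4 : F.Anc v₂ v₂ := Anc.rfl
  have a5 : F.Anc u₂ u₂ := Anc.rfl
  rcases swapParent_cases hp with ⟨rfl, rfl⟩ | ⟨rfl, rfl⟩ | ⟨rfl, rfl⟩ | ⟨h1, h2, h3, h4⟩
  · left; simp [swapZone, *]
  · left; simp [swapZone, *]
  · left; simp [swapZone, *]
  · right
    refine ⟨?_, h4⟩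
    have e : ∀ z, y ≠ z → (F.Anc z y ↔ F.Anc z x) := fun z hz =>
      ⟨fun h' => h'.anc_parent hz.symm h4, fun h' => h'.of_parent h4⟩
    classical
    unfold swapZone
    exact (if_congr (e _ h3) rfl (if_congr (e _ h1) rfl (if_congr (e _ h2) rfl rfl))).symm

/-- The forest obtained by exchanging two consecutive vertical paths. -/
noncomputable def swap (h : F.Consecutive u₁ u₂ v₁ v₂ w₁ w₂) : RootedForest S where
  parent := F.swapParent u₁ u₂ v₁ v₂ w₁ w₂
  mem_of_parent u v hp := by
    have h1 := F.mem_of_parent _ _ h.parent_u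
    have h2 := F.mem_of_parent _ _ h.parent_v
    have h3 := F.mem_of_parent _ _ h.parent_w
    rcases swapParent_cases hp with ⟨rfl, rfl⟩ | ⟨rfl, rfl⟩ | ⟨rfl, rfl⟩ | ⟨-, -, -, h4⟩
    · exact ⟨h1.1, h2.2⟩
    · exact ⟨h3.1, h1.2⟩
    · exact ⟨h2.1, h3.2⟩
    · exact F.mem_of_parent _ _ h4
  acyclic := by
    refine Subrelation.wf (r := InvImage
      (Prod.Lex (· < ·) fun u v => F.parent v = some u)
      fun x => (F.swapZone u₂ v₂ w₂ x, x)) ?_ (InvImage.wf _ (wellFounded_lt.prod_lex F.acyclic))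
    intro u v hp
    rcases h.zone_lt_or_parent hp with h' | ⟨h', h''⟩
    · exact Prod.Lex.left _ _ h'
    · simp only [InvImage]
      rw [h']
      exact Prod.Lex.right _ h''

theorem swap_parent_v (h : F.Consecutive u₁ u₂ v₁ v₂ w₁ w₂) : h.swap.parent v₂ = some u₁ := by
  simp [swap, swapParent]

theorem swap_parent_u (h : F.Consecutive u₁ u₂ v₁ v₂ w₁ w₂) : h.swap.parent u₂ = some w₁ := by
  simp [swap, swapParent, h.ne_uv]

theorem swap_parent_w (h : F.Consecutive u₁ u₂ v₁ v₂ w₁ w₂) : h.swap.parent w₂ = some v₁ := by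
  simp [swap, swapParent, h.ne_vw.symm, h.ne_uw.symm]

theorem swap_parent_of_ne (h : F.Consecutive u₁ u₂ v₁ v₂ w₁ w₂) {x : α} (hu : x ≠ u₂)
    (hv : x ≠ v₂) (hw : x ≠ w₂) : h.swap.parent x = F.parent x := by
  simp [swap, swapParent, hu, hv, hw]

theorem swap_edges (h : F.Consecutive u₁ u₂ v₁ v₂ w₁ w₂) :
    h.swap.edges = (F.edges \ {(u₁, u₂), (v₁, v₂), (w₁, w₂)}) ∪
      {(u₁, v₂), (w₁, u₂), (v₁, w₂)} := by
  ext ⟨x, y⟩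
  simp only [edges, Set.mem_ofPred_eq, Set.mem_union, Set.mem_sdiff, Set.mem_insert_iff,
    Set.mem_singleton_iff, Prod.mk.injEq]
  have h1 := h.ne_uv
  have h2 := h.ne_vw
  have h3 := h.ne_uw
  have p1 := h.parent_u
  have p2 := h.parent_v
  have p3 := h.parent_w
  have q1 := h.swap_parent_u
  have q2 := h.swap_parent_v
  have q3 := h.swap_parent_w
  have q4 := @swap_parent_of_ne _ _ _ _ _ _ _ _ _ h y
  by_cases hu : y = u₂
  · subst hu; grind
  by_cases hv : y = v₂
  · subst hv; grind
  by_cases hw : y = w₂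
  · subst hw; grind
  rw [q4 hu hv hw]
  grind

/-- A vertical path inside one zone survives the exchange. -/
theorem swap_anc_of_iff (h : F.Consecutive u₁ u₂ v₁ v₂ w₁ w₂) {x y : α} (hxy : F.Anc x y)
    (hu : F.Anc u₂ y → F.Anc u₂ x) (hv : F.Anc v₂ y → F.Anc v₂ x)
    (hw : F.Anc w₂ y → F.Anc w₂ x) : h.swap.Anc x y := by
  induction hxy with
  | refl => exact Anc.rfl
  | @tail b c hb hbc ih =>
    have key : ∀ z, (F.Anc z c → F.Anc z x) → c ≠ z := by
      rintro z hz rfl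
      exact Anc.not_of_parent hbc ((hz Anc.rfl).trans hb)
    refine (ih (fun h' => hu (h'.of_parent hbc)) (fun h' => hv (h'.of_parent hbc))
      (fun h' => hw (h'.of_parent hbc))).of_parent ?_
    rw [h.swap_parent_of_ne (key _ hu) (key _ hv) (key _ hw)]
    exact hbc

/-- The ancestor order after the exchange of two consecutive vertical paths. -/
theorem swap_anc_iff (h : F.Consecutive u₁ u₂ v₁ v₂ w₁ w₂) {x y : α} :
    h.swap.Anc x y ↔
      (F.Anc x y ∧ ¬ ((F.Anc u₂ x ∧ ¬ F.Anc v₂ x) ∧ (F.Anc v₂ y ∧ ¬ F.Anc w₂ y))) ∨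
      (F.Anc v₂ x ∧ F.Anc x w₁ ∧ F.Anc u₂ y ∧ ¬ F.Anc v₂ y) := by
  have n1 := Anc.not_of_parent h.parent_u
  have n2 := Anc.not_of_parent h.parent_v
  have n3 := Anc.not_of_parent h.parent_w
  have n4 : ¬ F.Anc v₂ u₂ := fun h' => n2 (h'.trans h.anc_uv)
  have n5 : ¬ F.Anc w₂ v₂ := fun h' => n3 (h'.trans h.anc_vw)
  have n8 : ¬ F.Anc v₂ u₁ := fun h' => n1 (h.anc_u_v.trans h')
  have a1 := h.anc_vw
  have a2 := h.anc_uv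
  have b1 := h.anc_u_v
  have b2 := h.anc_v_w
  have p1 := anc_of_parent h.parent_u
  have p2 := anc_of_parent h.parent_v
  have p3 := anc_of_parent h.parent_w
  have tr : ∀ {a b c}, F.Anc a b → F.Anc b c → F.Anc a c := Anc.trans
  have tot : ∀ {a b c}, F.Anc a c → F.Anc b c → F.Anc a b ∨ F.Anc b a := Anc.total
  have rf : ∀ a, F.Anc a a := fun a => Anc.rfl
  constructor
  · intro hxy
    induction hxy with
    | refl => left; exact ⟨Anc.rfl, by tauto⟩
    | @tail b c hb hbc ih =>
      rcases swapParent_cases hbc with ⟨rfl, rfl⟩ | ⟨rfl, rfl⟩ | ⟨rfl, rfl⟩ | ⟨h1, h2, h3, h4⟩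
      · clear hb hbc tot
        grind
      · clear hb hbc
        grind
      · clear hb hbc
        grind
      · have e : ∀ z, c ≠ z → (F.Anc z c ↔ F.Anc z b) := fun z hz =>
          ⟨fun h' => h'.anc_parent hz.symm h4, fun h' => h'.of_parent h4⟩
        rw [e _ h1, e _ h2, e _ h3]
        rcases ih with ⟨i1, i2⟩ | i
        · exact Or.inl ⟨i1.of_parent h4, i2⟩
        · exact Or.inr i
  · have T : ∀ {a b c}, h.swap.Anc a b → h.swap.Anc b c → h.swap.Anc a c := Anc.trans
    have e1 := anc_of_parent h.swap_parent_u
    have e2 := anc_of_parent h.swap_parent_v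
    have e3 := anc_of_parent h.swap_parent_w
    -- The converse cuts an old path at the zone boundaries: `Z` transports the pieces inside one
    -- zone, and the pieces are rejoined along the new chain from `u₁` through `v₂`, `w₁`, `u₂`,
    -- `v₁` to `w₂`.
    have Z := @swap_anc_of_iff _ _ _ _ _ _ _ _ _ h
    have s1 : h.swap.Anc v₂ w₁ := Z a1 (fun _ => b1) (fun _ => rf _) (fun h' => absurd h' n3)
    have s2 : h.swap.Anc u₂ v₁ := Z a2 (fun _ => rf _) (fun h' => absurd h' n2)
      (fun h' => absurd (b2.trans h') n2)
    have toW : ∀ {c}, F.Anc w₂ c → h.swap.Anc v₁ c := fun {c} hc =>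
      e3.trans (Z hc (fun _ => b1.trans b2) (fun _ => b2) (fun _ => rf _))
    have toA : ∀ {c}, F.Anc u₂ c → ¬ F.Anc v₂ c → h.swap.Anc w₁ c := fun {c} hc hc' =>
      e1.trans (Z hc (fun _ => rf _) (fun h' => absurd h' hc')
        (fun h' => absurd (b2.trans h') hc'))
    have toB : ∀ {c}, F.Anc v₂ c → ¬ F.Anc w₂ c → h.swap.Anc u₁ c := fun {c} hc hc' =>
      e2.trans (Z hc (fun _ => b1) (fun _ => rf _) (fun h' => absurd h' hc'))
    have par : ∀ {x y z}, F.Anc x y → x ≠ y → F.parent y = some z → F.Anc x z := Anc.anc_parent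
    rintro (⟨hxy, hn⟩ | ⟨h1, h2, h3, h4⟩)
    · by_cases yw : F.Anc w₂ y
      · by_cases xw : F.Anc w₂ x
        · exact Z hxy (fun _ => tr (tr b1 b2) xw) (fun _ => tr b2 xw) (fun _ => xw)
        · have hxw : F.Anc x w₁ := by
            have : F.Anc x w₂ := (tot hxy yw).resolve_right xw
            exact par this (fun h' => xw (h' ▸ rf _)) h.parent_w
          have w1n : h.swap.Anc w₁ y := e1.trans (s2.trans (toW yw))
          by_cases xv : F.Anc v₂ x
          · exact (Z hxw (fun _ => tr b1 xv) (fun _ => xv) (fun h' => absurd h' n3)).trans w1n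
          · have hxv : F.Anc x v₁ := by
              have : F.Anc x v₂ := (tot hxw a1).resolve_right xv
              exact par this (fun h' => xv (h' ▸ rf _)) h.parent_v
            by_cases xu : F.Anc u₂ x
            · exact (Z hxv (fun _ => xu) (fun h' => absurd h' n2)
                (fun h' => absurd (b2.trans h') n2)).trans (toW yw)
            · have hxu : F.Anc x u₁ := by
                have : F.Anc x u₂ := (tot hxv a2).resolve_right xu
                exact par this (fun h' => xu (h' ▸ rf _)) h.parent_u
              exact (Z hxu (fun h' => absurd h' n1) (fun h' => absurd h' n8)
                (fun h' => absurd (b2.trans h') n8)).trans (e2.trans (s1.trans w1n))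
      · by_cases yu : F.Anc u₂ y
        · by_cases xu : F.Anc u₂ x
          · refine Z hxy (fun _ => xu) (fun h' => ?_) (fun h' => absurd h' yw)
            by_contra h''
            exact hn ⟨⟨xu, h''⟩, h', yw⟩
          · have hxu : F.Anc x u₁ := by
              have : F.Anc x u₂ := (tot hxy yu).resolve_right xu
              exact par this (fun h' => xu (h' ▸ rf _)) h.parent_u
            refine (Z hxu (fun h' => absurd h' n1) (fun h' => absurd h' n8)
              (fun h' => absurd (b2.trans h') n8)).trans ?_
            by_cases yv : F.Anc v₂ y
            · exact toB yv yw
            · exact e2.trans (s1.trans (toA yu yv))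
        · exact Z hxy (fun h' => absurd h' yu) (fun h' => absurd (tr b1 h') yu)
            (fun h' => absurd h' yw)
    · exact (Z h2 (fun _ => tr b1 h1) (fun _ => h1) (fun h' => absurd h' n3)).trans (toA h3 h4)

end Consecutive

end RootedForest

end HWidth

namespace HWidth

variable {α : Type u} {H : Hypergraph α}

/-! ### Separators in a forest -/

/-- The ancestors of `x` that are adjacent to a descendant of `y`. -/
def RootedForest.cut (F : RootedForest H.vertexSet) (x y : α) : Set α :=
  {v | F.Anc v x ∧ ∃ w, F.Anc y w ∧ H.Adj v w}

theorem mem_vertexSet_of_adj {x y : α} (h : H.Adj x y) : x ∈ H.vertexSet := by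
  obtain ⟨e, he, hx, -⟩ := h
  exact H.subset_vertexSet_of_mem_edgeSet' he hx

theorem Proper.adj_self (hH : Proper H) {x : α} (hx : x ∈ H.vertexSet) : H.Adj x x := by
  have := hH.not_isolated x hx
  simp only [Hypergraph.IsIsolated, not_forall, not_not] at this
  obtain ⟨e, he, hxe⟩ := this
  exact ⟨e, he, hxe, hxe⟩

theorem RootedForest.cut_subset (F : RootedForest H.vertexSet) (x y : α) :
    F.cut x y ⊆ H.vertexSet := by
  rintro v ⟨-, w, -, h⟩
  exact mem_vertexSet_of_adj h

/-- A vertex lies in some edge and so is adjacent to itself, which places $u$ in its own cut. Bags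
and separators can then be treated as one notion. -/
theorem ElimForest.bag_eq_cut (hH : Proper H) (F : ElimForest H) {u : α}
    (hu : u ∈ H.vertexSet) : F.bag u = F.cut u u := by
  ext v
  constructor
  · rintro (rfl | ⟨h, -, h'⟩)
    · exact ⟨.rfl, v, .rfl, hH.adj_self hu⟩
    · exact ⟨h, h'⟩
  · rintro ⟨h, h'⟩
    by_cases hv : v = u
    · exact Or.inl hv
    · exact Or.inr ⟨h, hv, h'⟩

theorem ElimForest.le_width (hH : Proper H) (F : ElimForest H) (f : WidthFunction.{u}) {u : α}
    (hu : u ∈ H.vertexSet) : f H (F.bag u) ≤ F.width f := by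
  have : Finite H.vertexSet := hH.finite
  exact le_ciSup (f := fun u : H.vertexSet => f H (F.bag u)) (Set.finite_range _).bddAbove ⟨u, hu⟩

/-! ### Balls and the exchange property -/

/-- The vertices at distance at most `t` from `X`. -/
def ball (H : Hypergraph α) (X : Set α) : ℕ → Set α
  | 0 => X
  | t + 1 => ball H X t ∪ {y | ∃ x ∈ ball H X t, H.Adj x y}

theorem ball_mono (X : Set α) : Monotone (ball H X) :=
  monotone_nat_of_le_succ fun _ => Set.subset_union_left

theorem ball_subset {X : Set α} (hX : X ⊆ H.vertexSet) (t : ℕ) : ball H X t ⊆ H.vertexSet := by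
  induction t with
  | zero => exact hX
  | succ t ih =>
    rintro y (hy | ⟨x, -, hy⟩)
    · exact ih hy
    · exact mem_vertexSet_of_adj hy.symm

/-- A small set misses one of the first layers around `X`. -/
theorem exists_disjoint_layer (X : Set α) {B : Set α} (hB : B.Finite) {N : ℕ}
    (hN : B.ncard ≤ N) : ∃ t ≤ N, ∀ x ∈ B, x ∈ ball H X (t + 1) → x ∈ ball H X t := by
  by_contra! hcon
  obtain ⟨x₀, -⟩ := hcon 0 (Nat.zero_le N)
  have : Nonempty α := ⟨x₀⟩
  choose! g hgB hg1 hg0 using hcon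
  -- If all layers $0,\dots,N$ met `B`, these disjoint layers would give $N+1$ distinct elements of
  -- `B`.
  have hinj : Set.InjOn g (Set.Iic N) := by
    intro s hs t ht hst
    rcases lt_trichotomy s t with h | h | h
    · exact absurd (ball_mono X (Nat.succ_le_of_lt h) (hg1 s hs)) (hst ▸ hg0 t ht)
    · exact h
    · exact absurd (ball_mono X (Nat.succ_le_of_lt h) (hg1 t ht)) (hst ▸ hg0 s hs)
  have h1 := Set.ncard_le_ncard (s := g '' Set.Iic N) (t := B)
    (by rintro _ ⟨t, ht, rfl⟩; exact hgB t ht) hB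
  rw [hinj.ncard_image] at h1
  have h2 : (Set.Iic N).ncard = N + 1 := by
    rw [← Finset.coe_Iic, Set.ncard_coe_finset, Nat.card_Iic]
  omega

/-- Parts of two sets that agree near `X` can be exchanged without changing the total width. -/
theorem WeaklyManageable.exchange {f : WidthFunction.{u}} (hf : WeaklyManageable f)
    (hH : Proper H) {P Q X A A' B B' Y : Set α} {N : ℕ}
    (hP : P ⊆ H.vertexSet) (hQ : Q ⊆ H.vertexSet) (hX : X ⊆ H.vertexSet)
    (hPQ : ∀ x ∈ P, ∀ y ∈ Q, ¬ H.Adj x y) (dPQ : Disjoint P Q) (dXQ : Disjoint X Q)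
    (hA : A ⊆ P) (hA' : A' ⊆ P) (hB : B ⊆ Q) (hB' : B' ⊆ Q) (hY : Y ⊆ X)
    (hN : B.ncard ≤ N) (hBB : ball H X (N + 1) ∩ B = ball H X (N + 1) ∩ B') :
    f H (A ∪ Y ∪ B) + f H (A' ∪ Y ∪ B') = f H (A ∪ Y ∪ B') + f H (A' ∪ Y ∪ B) := by
  obtain ⟨t, htN, ht⟩ := exists_disjoint_layer (H := H) X (hH.finite.subset (hB.trans hQ)) hN
  have hmem : ∀ x ∈ ball H X (N + 1), (x ∈ B ↔ x ∈ B') := fun x hx => by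
    have := Set.ext_iff.1 hBB x
    simpa [hx] using this
  have ht1 : ball H X t ⊆ ball H X (N + 1) := ball_mono X (by omega)
  have ht2 : ball H X (t + 1) ⊆ ball H X (N + 1) := ball_mono X (by omega)
  have ht' : ∀ x ∈ B', x ∈ ball H X (t + 1) → x ∈ ball H X t := fun x hx h =>
    ht x ((hmem x (ht2 h)).2 hx) h
  have hZ : B' ∩ ball H X t = B ∩ ball H X t := by
    ext x
    constructor <;> rintro ⟨h, h'⟩
    · exact ⟨(hmem x (ht1 h')).2 h, h'⟩
    · exact ⟨(hmem x (ht1 h')).1 h, h'⟩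
  -- The empty layer after the ball of radius `t` separates the far part of `B` from everything
  -- else; the near part is common to `B` and `B'`.
  have key : ∀ A ⊆ P, ∀ B ⊆ Q, (∀ x ∈ B, x ∈ ball H X (t + 1) → x ∈ ball H X t) →
      f H (A ∪ Y ∪ B) = f H (A ∪ Y ∪ B ∩ ball H X t) + f H (B \ ball H X t) := by
    intro A hA B hB hBt
    rw [← hf.weak_additivity H hH]
    · rw [Set.union_assoc (A ∪ Y), Set.inter_union_sdiff]
    · exact Set.union_subset (Set.union_subset (hA.trans hP) (hY.trans hX))
        (Set.inter_subset_left.trans (hB.trans hQ))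
    · exact Set.sdiff_subset.trans (hB.trans hQ)
    · rw [Set.disjoint_left]
      rintro x ((hx | hx) | hx) hx'
      · exact Set.disjoint_left.1 dPQ (hA hx) (hB hx'.1)
      · exact Set.disjoint_left.1 dXQ (hY hx) (hB hx'.1)
      · exact hx'.2 hx.2
    · have near : ∀ x ∈ ball H X t, ∀ y ∈ B \ ball H X t, ¬ H.Adj x y := fun x hx y hy hxy =>
        hy.2 (hBt y hy.1 (Or.inr ⟨x, hx, hxy⟩))
      rintro x ((hx | hx) | hx) y hy
      · exact hPQ x (hA hx) y (hB hy.1)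
      · exact near x (ball_mono X (Nat.zero_le t) (hY hx)) y hy
      · exact near x hx.2 y hy
  rw [key A hA B hB ht, key A' hA' B' hB' ht', key A hA B' hB' ht', key A' hA' B hB ht, hZ]
  ring

/-! ### Elimination forests after an exchange -/

namespace RootedForest.Consecutive

variable {F : ElimForest H} {u₁ u₂ v₁ v₂ w₁ w₂ : α} {P Q X : Set α}

/-- The elimination forest obtained by exchanging two consecutive vertical paths of different
colours. -/
noncomputable def swapElim (h : F.Consecutive u₁ u₂ v₁ v₂ w₁ w₂)
    (hA : ∀ x, F.Anc u₂ x → ¬ F.Anc v₂ x → x ∈ P) (hB : ∀ x, F.Anc v₂ x → ¬ F.Anc w₂ x → x ∈ Q)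
    (hPQ : ∀ x ∈ P, ∀ y ∈ Q, ¬ H.Adj x y) : ElimForest H where
  toRootedForest := h.swap
  comparable := by
    -- The only old relations that are lost go from the upper zone to the lower one, and no edge
    -- joins these.
    have key : ∀ x y, H.Adj x y → F.Anc x y → h.swap.Anc x y := fun x y hxy hanc =>
      h.swap_anc_iff.2 (Or.inl ⟨hanc, fun hn =>
        hPQ x (hA x hn.1.1 hn.1.2) y (hB y hn.2.1 hn.2.2) hxy⟩)
    intro e he x hx y hy
    rcases F.comparable e he x hx y hy with h' | h'
    · exact Or.inl (key x y ⟨e, he, hx, hy⟩ h')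
    · exact Or.inr (key y x ⟨e, he, hy, hx⟩ h')

/-- Outside the two exchanged paths the bags do not change. -/
theorem swap_cut_of_not_anc (h : F.Consecutive u₁ u₂ v₁ v₂ w₁ w₂)
    (hA : ∀ x, F.Anc u₂ x → ¬ F.Anc v₂ x → x ∈ P) (hB : ∀ x, F.Anc v₂ x → ¬ F.Anc w₂ x → x ∈ Q)
    (hPQ : ∀ x ∈ P, ∀ y ∈ Q, ¬ H.Adj x y) {u : α}
    (hu : F.Anc u₂ u → ¬ F.Anc v₂ u → ¬ F.Anc u v₁)
    (hu' : F.Anc v₂ u → ¬ F.Anc w₂ u → ¬ F.Anc u w₁) : h.swap.cut u u = F.cut u u := by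
  have n1 := Anc.not_of_parent h.parent_u
  have n2 := Anc.not_of_parent h.parent_v
  have n3 := Anc.not_of_parent h.parent_w
  have a1 := h.anc_vw
  have a2 := h.anc_uv
  have b1 := h.anc_u_v
  have b2 := h.anc_v_w
  have p2 := anc_of_parent h.parent_v
  have p3 := anc_of_parent h.parent_w
  have tr : ∀ {a b c}, F.Anc a b → F.Anc b c → F.Anc a c := Anc.trans
  have tot : ∀ {a b c}, F.Anc a c → F.Anc b c → F.Anc a b ∨ F.Anc b a := Anc.total
  have par : ∀ {x y z}, F.Anc x y → x ≠ y → F.parent y = some z → F.Anc x z := Anc.anc_parent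
  have e1 := h.parent_v
  have e2 := h.parent_w
  have hPQ' : ∀ x ∈ Q, ∀ y ∈ P, ¬ H.Adj x y := fun x hx y hy h' => hPQ y hy x hx h'.symm
  ext v
  simp only [cut, Set.mem_ofPred_eq, h.swap_anc_iff]
  by_cases c1 : F.Anc u₂ u ∧ ¬ F.Anc v₂ u
  · have d1 : ∀ w, F.Anc u w → F.Anc u₂ w ∧ ¬ F.Anc v₂ w := by
      intro w hw
      refine ⟨tr c1.1 hw, fun h' => ?_⟩
      rcases tot hw h' with h'' | h''
      · exact hu c1.1 c1.2 (par h'' (fun e => c1.2 (e ▸ Anc.rfl)) e1)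
      · exact c1.2 h''
    constructor
    · rintro ⟨i1, w, i2, i3⟩
      have i2' : F.Anc u w := by grind
      refine ⟨?_, w, i2', i3⟩
      rcases i1 with i1 | i1
      · exact i1.1
      · exact absurd i3 (hPQ' v (hB v i1.1 (fun h' => n3 (tr h' i1.2.1))) w
          (hA w (d1 w i2').1 (d1 w i2').2))
    · rintro ⟨i1, w, i2, i3⟩
      exact ⟨Or.inl ⟨i1, fun h' => c1.2 h'.2.1⟩, w,
        Or.inl ⟨i2, fun h' => (d1 w i2).2 h'.2.1⟩, i3⟩
  · by_cases c2 : F.Anc v₂ u ∧ ¬ F.Anc w₂ u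
    · have hu'' := hu' c2.1 c2.2
      have d1 : ∀ w, F.Anc u w → F.Anc v₂ w ∧ ¬ F.Anc w₂ w := by
        intro w hw
        refine ⟨tr c2.1 hw, fun h' => ?_⟩
        rcases tot hw h' with h'' | h''
        · exact hu'' (par h'' (fun e => c2.2 (e ▸ Anc.rfl)) e2)
        · exact c2.2 h''
      constructor
      · rintro ⟨i1, w, i2, i3⟩
        refine ⟨?_, w, ?_, i3⟩ <;> grind
      · rintro ⟨i1, w, i2, i3⟩
        refine ⟨Or.inl ⟨i1, fun h' => ?_⟩, w, Or.inl ⟨i2, fun h' => h'.1.2 c2.1⟩, i3⟩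
        exact hPQ v (hA v h'.1.1 h'.1.2) w (hB w (d1 w i2).1 (d1 w i2).2) i3
    · constructor
      · rintro ⟨i1, w, i2, i3⟩
        refine ⟨?_, w, ?_, i3⟩ <;> grind
      · rintro ⟨i1, w, i2, i3⟩
        refine ⟨Or.inl ⟨i1, fun h' => c2 h'.2⟩, w, Or.inl ⟨i2, fun h' => c1 h'.1⟩, i3⟩

end RootedForest.Consecutive

end HWidth

/-! ### Bags on the exchanged paths and the width of the new forest. -/

namespace HWidth

variable {α : Type u} {H : Hypergraph α}

namespace RootedForest.Consecutive

variable {F : ElimForest H} {u₁ u₂ v₁ v₂ w₁ w₂ : α} {P Q X : Set α}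

/-- Bags on the upper path: the part of the other colour is a separator, which moves from the
edge between the two paths to the edge below them. -/
theorem swap_cut_upper (h : F.Consecutive u₁ u₂ v₁ v₂ w₁ w₂)
    (hA : ∀ x, F.Anc u₂ x → ¬ F.Anc v₂ x → x ∈ P) (hB : ∀ x, F.Anc v₂ x → ¬ F.Anc w₂ x → x ∈ Q)
    (hPQ : ∀ x ∈ P, ∀ y ∈ Q, ¬ H.Adj x y) (dPQ : ∀ x ∈ P, x ∉ Q) (dPX : ∀ x ∈ P, x ∉ X)
    (dXQ : ∀ x ∈ X, x ∉ Q)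
    (hab : ∀ x ∈ X, x ∈ F.cut u₁ u₂ → x ∈ F.cut v₁ v₂)
    (hbc : ∀ x ∈ X, x ∈ F.cut v₁ v₂ → x ∈ F.cut w₁ w₂)
    {u : α} (hu : F.Anc u₂ u) (hu' : F.Anc u v₁) :
    F.cut u u ∩ P = h.swap.cut u u ∩ P ∧ F.cut u u ∩ Q = F.cut v₁ v₂ ∩ Q ∧
      h.swap.cut u u ∩ Q = F.cut w₁ w₂ ∩ Q ∧ F.cut u u ∩ X = F.cut v₁ v₂ ∩ X ∧
      h.swap.cut u u ∩ X = F.cut v₁ v₂ ∩ X ∧ F.cut v₁ v₂ ∩ P = F.cut w₁ w₂ ∩ P ∧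
      F.cut v₁ v₂ ∩ X = F.cut w₁ w₂ ∩ X := by
  have n1 := Anc.not_of_parent h.parent_u
  have n2 := Anc.not_of_parent h.parent_v
  have n3 := Anc.not_of_parent h.parent_w
  have a1 := h.anc_vw
  have a2 := h.anc_uv
  have b1 := h.anc_u_v
  have b2 := h.anc_v_w
  have p2 := anc_of_parent h.parent_v
  have p3 := anc_of_parent h.parent_w
  have tr : ∀ {a b c}, F.Anc a b → F.Anc b c → F.Anc a c := Anc.trans
  have tot : ∀ {a b c}, F.Anc a c → F.Anc b c → F.Anc a b ∨ F.Anc b a := Anc.total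
  have parU : ∀ {x}, F.Anc x v₁ → ¬ F.Anc u₂ x → F.Anc x u₁ := fun {x} hx hx' =>
    ((tot hx a2).resolve_right hx').anc_parent (fun e => hx' (e ▸ Anc.rfl)) h.parent_u
  have parV : ∀ {x}, F.Anc x w₁ → ¬ F.Anc v₂ x → F.Anc x v₁ := fun {x} hx hx' =>
    ((tot hx a1).resolve_right hx').anc_parent (fun e => hx' (e ▸ Anc.rfl)) h.parent_v
  have hPQ' : ∀ x ∈ Q, ∀ y ∈ P, ¬ H.Adj x y := fun x hx y hy h' => hPQ y hy x hx h'.symm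
  have nu : ¬ F.Anc v₂ u := fun h' => n2 (tr h' hu')
  have notA : ∀ {x}, x ∉ P → F.Anc x v₁ → F.Anc x u₁ := fun {x} hx hx' =>
    parU hx' fun h' => hx (hA x h' fun h'' => n2 (tr h'' hx'))
  have up : ∀ {x}, F.Anc x v₁ → x ∉ P → F.Anc x u := by
    intro x hx hxP
    refine (tot hx hu').resolve_right fun h' => hxP (hA x (tr hu h') fun h'' => n2 (tr h'' hx))
  simp only [Set.ext_iff, Set.mem_inter_iff, cut, Set.mem_ofPred_eq, h.swap_anc_iff] at hab hbc ⊢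
  refine ⟨?_, ?_, ?_, ?_, ?_, ?_, ?_⟩
  · intro v
    refine and_congr_left fun hv => ⟨?_, ?_⟩
    · rintro ⟨i1, w, i2, i3⟩
      exact ⟨Or.inl ⟨i1, fun h' => nu h'.2.1⟩, w,
        Or.inl ⟨i2, fun h' => hPQ v hv w (hB w h'.2.1 h'.2.2) i3⟩, i3⟩
    · rintro ⟨i1, w, i2, i3⟩
      refine ⟨?_, w, ?_, i3⟩ <;> grind
  · intro v
    refine and_congr_left fun hv => ⟨?_, ?_⟩
    · rintro ⟨i1, w, i2, i3⟩
      refine ⟨tr i1 hu', w, ?_, i3⟩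
      grind
    · rintro ⟨i1, w, i2, i3⟩
      exact ⟨up i1 (fun h' => dPQ v h' hv), w, tr hu' (tr p2 i2), i3⟩
  · intro v
    refine and_congr_left fun hv => ⟨?_, ?_⟩
    · rintro ⟨i1, w, i2, i3⟩
      refine ⟨?_, w, ?_, i3⟩ <;> grind
    · rintro ⟨i1, w, i2, i3⟩
      refine ⟨?_, w, Or.inl ⟨tr hu' (tr p2 (tr b2 i2)), fun h' => h'.2.2 i2⟩, i3⟩
      by_cases hv' : F.Anc v₂ v
      · exact Or.inr ⟨hv', i1, hu, nu⟩
      · exact Or.inl ⟨up (parV i1 hv') (fun h' => dPQ v h' hv), fun h' => nu h'.2.1⟩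
  · intro v
    refine and_congr_left fun hv => ⟨?_, ?_⟩
    · rintro ⟨i1, w, i2, i3⟩
      -- A vertex of `X` above `u` lies above the upper zone, hence in the separator at `(u₁, u₂)`;
      -- `hab` moves it to the next separator.
      exact hab v hv ⟨notA (fun h' => dPX v h' hv) (tr i1 hu'), w, tr hu i2, i3⟩
    · rintro ⟨i1, w, i2, i3⟩
      exact ⟨up i1 (fun h' => dPX v h' hv), w, tr hu' (tr p2 i2), i3⟩
  · intro v
    refine and_congr_left fun hv => ⟨?_, ?_⟩
    · rintro ⟨i1, w, i2, i3⟩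
      have i1' : F.Anc v u := i1.elim (fun h' => h'.1) fun h' =>
        absurd (hB v h'.1 fun h'' => n3 (tr h'' h'.2.1)) (dXQ v hv)
      have i2' : F.Anc u₂ w := i2.elim (fun h' => tr hu h'.1) fun h' => h'.2.2.1
      exact hab v hv ⟨notA (fun h' => dPX v h' hv) (tr i1' hu'), w, i2', i3⟩
    · intro hc
      -- The lower zone is no longer below `u`, so the neighbour has to be taken below `w₂`.
      obtain ⟨-, w, i2, i3⟩ := hbc v hv hc
      exact ⟨Or.inl ⟨up hc.1 (fun h' => dPX v h' hv), fun h' => nu h'.2.1⟩, w,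
        Or.inl ⟨tr hu' (tr p2 (tr b2 i2)), fun h' => h'.2.2 i2⟩, i3⟩
  · intro v
    refine and_congr_left fun hv => ⟨?_, ?_⟩
    · rintro ⟨i1, w, i2, i3⟩
      refine ⟨tr i1 (tr p2 a1), w, ?_, i3⟩
      grind
    · rintro ⟨i1, w, i2, i3⟩
      refine ⟨parV i1 fun h' => dPQ v hv (hB v h' fun h'' => n3 (tr h'' i1)), w, tr b2 i2, i3⟩
  · intro v
    refine and_congr_left fun hv => ⟨hbc v hv, ?_⟩
    rintro ⟨i1, w, i2, i3⟩
    refine ⟨parV i1 fun h' => dXQ v hv (hB v h' fun h'' => n3 (tr h'' i1)), w, tr b2 i2, i3⟩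

/-- Bags on the lower path: the part of the other colour is a separator, which moves from the
edge between the two paths to the edge above them. -/
theorem swap_cut_lower (h : F.Consecutive u₁ u₂ v₁ v₂ w₁ w₂)
    (hA : ∀ x, F.Anc u₂ x → ¬ F.Anc v₂ x → x ∈ P) (hB : ∀ x, F.Anc v₂ x → ¬ F.Anc w₂ x → x ∈ Q)
    (hPQ : ∀ x ∈ P, ∀ y ∈ Q, ¬ H.Adj x y) (dPQ : ∀ x ∈ P, x ∉ Q) (dPX : ∀ x ∈ P, x ∉ X)
    (dXQ : ∀ x ∈ X, x ∉ Q)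
    (hab : ∀ x ∈ X, x ∈ F.cut u₁ u₂ → x ∈ F.cut v₁ v₂)
    (hbc : ∀ x ∈ X, x ∈ F.cut v₁ v₂ → x ∈ F.cut w₁ w₂)
    {u : α} (hu : F.Anc v₂ u) (hu' : F.Anc u w₁) :
    F.cut u u ∩ Q = h.swap.cut u u ∩ Q ∧ F.cut u u ∩ P = F.cut v₁ v₂ ∩ P ∧
      h.swap.cut u u ∩ P = F.cut u₁ u₂ ∩ P ∧ F.cut u u ∩ X = F.cut v₁ v₂ ∩ X ∧
      h.swap.cut u u ∩ X = F.cut v₁ v₂ ∩ X ∧ F.cut v₁ v₂ ∩ Q = F.cut u₁ u₂ ∩ Q ∧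
      F.cut v₁ v₂ ∩ X = F.cut u₁ u₂ ∩ X := by
  have n1 := Anc.not_of_parent h.parent_u
  have n2 := Anc.not_of_parent h.parent_v
  have n3 := Anc.not_of_parent h.parent_w
  have a1 := h.anc_vw
  have a2 := h.anc_uv
  have b1 := h.anc_u_v
  have b2 := h.anc_v_w
  have p1 := anc_of_parent h.parent_u
  have p2 := anc_of_parent h.parent_v
  have p3 := anc_of_parent h.parent_w
  have tr : ∀ {a b c}, F.Anc a b → F.Anc b c → F.Anc a c := Anc.trans
  have tot : ∀ {a b c}, F.Anc a c → F.Anc b c → F.Anc a b ∨ F.Anc b a := Anc.total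
  have parU : ∀ {x}, F.Anc x v₁ → ¬ F.Anc u₂ x → F.Anc x u₁ := fun {x} hx hx' =>
    ((tot hx a2).resolve_right hx').anc_parent (fun e => hx' (e ▸ Anc.rfl)) h.parent_u
  have parV : ∀ {x}, F.Anc x w₁ → ¬ F.Anc v₂ x → F.Anc x v₁ := fun {x} hx hx' =>
    ((tot hx a1).resolve_right hx').anc_parent (fun e => hx' (e ▸ Anc.rfl)) h.parent_v
  have hPQ' : ∀ x ∈ Q, ∀ y ∈ P, ¬ H.Adj x y := fun x hx y hy h' => hPQ y hy x hx h'.symm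
  have nu : ¬ F.Anc w₂ u := fun h' => n3 (tr h' hu')
  have notB : ∀ {x}, x ∉ Q → F.Anc x w₁ → F.Anc x v₁ := fun {x} hx hx' =>
    parV hx' fun h' => hx (hB x h' fun h'' => n3 (tr h'' hx'))
  have notA : ∀ {x}, x ∉ P → F.Anc x v₁ → F.Anc x u₁ := fun {x} hx hx' =>
    parU hx' fun h' => hx (hA x h' fun h'' => n2 (tr h'' hx'))
  have uu : F.Anc u₁ u := tr p1 (tr b1 hu)
  have vu : F.Anc v₁ u := tr p2 hu
  have offA : ∀ {x}, F.Anc x u₁ → ¬ F.Anc u₂ x := fun hx h' => n1 (tr h' hx)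
  have offB : ∀ {x}, F.Anc x v₁ → ¬ F.Anc v₂ x := fun hx h' => n2 (tr h' hx)
  have uw : ∀ {x}, F.Anc w₂ x → F.Anc u x := fun hx => tr hu' (tr p3 hx)
  simp only [Set.ext_iff, Set.mem_inter_iff, cut, Set.mem_ofPred_eq, h.swap_anc_iff] at hab hbc ⊢
  refine ⟨?_, ?_, ?_, ?_, ?_, ?_, ?_⟩
  · intro v
    refine and_congr_left fun hv => ⟨?_, ?_⟩
    · rintro ⟨i1, w, i2, i3⟩
      exact ⟨Or.inl ⟨i1, fun h' => dPQ v (hA v h'.1.1 h'.1.2) hv⟩, w,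
        Or.inl ⟨i2, fun h' => h'.1.2 hu⟩, i3⟩
    · rintro ⟨i1, w, i2, i3⟩
      refine ⟨?_, w, ?_, i3⟩ <;> grind
  · intro v
    refine and_congr_left fun hv => ⟨?_, ?_⟩
    · rintro ⟨i1, w, i2, i3⟩
      exact ⟨notB (dPQ v hv) (tr i1 hu'), w, tr hu i2, i3⟩
    · rintro ⟨i1, w, i2, i3⟩
      refine ⟨tr i1 vu, w, uw ?_, i3⟩
      by_contra h'
      exact hPQ v hv w (hB w i2 h') i3
  · intro v
    refine and_congr_left fun hv => ⟨?_, ?_⟩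
    · rintro ⟨i1, w, i2, i3⟩
      have i1' : F.Anc v u := by grind
      have j := notB (dPQ v hv) (tr i1' hu')
      refine ⟨parU j ?_, w, ?_, i3⟩
      · intro h'
        rcases i1 with i1 | i1
        · exact i1.2 ⟨⟨h', offB j⟩, hu, nu⟩
        · exact i1.2.2.2 hu
      · rcases i2 with i2 | i2
        · exact tr b1 (tr hu i2.1)
        · exact i2.2.2.1
    · rintro ⟨i1, w, i2, i3⟩
      refine ⟨Or.inl ⟨tr i1 uu, fun h' => offA i1 h'.1.1⟩, w, ?_, i3⟩
      -- After the exchange the upper zone lies below `u`. A neighbour in the lower zone is excluded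
      -- by its colour, and one below `w₂` is still below `u`.
      by_cases hw : F.Anc v₂ w
      · have : F.Anc w₂ w := by
          by_contra h'
          exact hPQ v hv w (hB w hw h') i3
        exact Or.inl ⟨uw this, fun h' => h'.1.2 hu⟩
      · exact Or.inr ⟨hu, hu', i2, hw⟩
  · intro v
    refine and_congr_left fun hv => ⟨?_, ?_⟩
    · rintro ⟨i1, w, i2, i3⟩
      exact ⟨notB (dXQ v hv) (tr i1 hu'), w, tr hu i2, i3⟩
    · intro hc
      obtain ⟨-, w, i2, i3⟩ := hbc v hv hc
      exact ⟨tr hc.1 vu, w, uw i2, i3⟩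
  · intro v
    have dXP : v ∈ X → v ∉ P := fun h1 h2 => dPX v h2 h1
    refine and_congr_left fun hv => ⟨?_, ?_⟩
    · rintro ⟨i1, w, i2, i3⟩
      have i1' : F.Anc v u := by grind
      refine hab v hv ⟨notA (dXP hv) (notB (dXQ v hv) (tr i1' hu')), w, ?_, i3⟩
      rcases i2 with i2 | i2
      · exact tr b1 (tr hu i2.1)
      · exact i2.2.2.1
    · intro hc
      obtain ⟨-, w, i2, i3⟩ := hbc v hv hc
      exact ⟨Or.inl ⟨tr hc.1 vu, fun h' => offA (notA (dXP hv) hc.1) h'.1.1⟩, w,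
        Or.inl ⟨uw i2, fun h' => h'.1.2 hu⟩, i3⟩
  · intro v
    refine and_congr_left fun hv => ⟨?_, ?_⟩
    · rintro ⟨i1, w, i2, i3⟩
      exact ⟨notA (fun h' => dPQ v h' hv) i1, w, tr b1 i2, i3⟩
    · rintro ⟨i1, w, i2, i3⟩
      refine ⟨tr i1 (tr p1 a2), w, ?_, i3⟩
      by_contra h'
      exact hPQ' v hv w (hA w i2 h') i3
  · intro v
    refine and_congr_left fun hv => ⟨?_, hab v hv⟩
    rintro ⟨i1, w, i2, i3⟩
    exact ⟨notA (fun h' => dPX v h' hv) i1, w, tr b1 i2, i3⟩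

theorem eq_parts {V S : Set α} (hV : V ⊆ P ∪ X ∪ Q) (hS : S ⊆ V) :
    S = S ∩ P ∪ S ∩ X ∪ S ∩ Q := by
  rw [← Set.inter_union_distrib_left, ← Set.inter_union_distrib_left,
    Set.inter_eq_left.2 (hS.trans hV)]

/-- If the separator between two consecutive paths of different colours has at least the width of
the separators above and below them, and the three separators agree near `X`, then exchanging the
paths does not increase the width. -/
theorem swapElim_width_le (h : F.Consecutive u₁ u₂ v₁ v₂ w₁ w₂)
    (hA : ∀ x, F.Anc u₂ x → ¬ F.Anc v₂ x → x ∈ P) (hB : ∀ x, F.Anc v₂ x → ¬ F.Anc w₂ x → x ∈ Q)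
    (hPQ : ∀ x ∈ P, ∀ y ∈ Q, ¬ H.Adj x y)
    {f : WidthFunction.{u}} (hf : WeaklyManageable f) (hH : Proper H)
    (hV : P ∪ X ∪ Q = H.vertexSet) (dPQ : Disjoint P Q) (dPX : Disjoint P X) (dXQ : Disjoint X Q)
    {N : ℕ} (hN : (F.cut v₁ v₂).ncard ≤ N)
    (hab : ball H X (N + 1) ∩ F.cut u₁ u₂ = ball H X (N + 1) ∩ F.cut v₁ v₂)
    (hbc : ball H X (N + 1) ∩ F.cut v₁ v₂ = ball H X (N + 1) ∩ F.cut w₁ w₂)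
    (hle : f H (F.cut u₁ u₂) ≤ f H (F.cut v₁ v₂)) (hle' : f H (F.cut w₁ w₂) ≤ f H (F.cut v₁ v₂)) :
    (h.swapElim hA hB hPQ).width f ≤ F.width f := by
  have : Finite H.vertexSet := hH.finite
  have hP : P ⊆ H.vertexSet := by rw [← hV]; exact fun x hx => Or.inl (Or.inl hx)
  have hX : X ⊆ H.vertexSet := by rw [← hV]; exact fun x hx => Or.inl (Or.inr hx)
  have hQ : Q ⊆ H.vertexSet := by rw [← hV]; exact fun x hx => Or.inr hx
  have hXball : ∀ x ∈ X, x ∈ ball H X (N + 1) := fun x hx => ball_mono X (Nat.zero_le _) hx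
  have hab' : ∀ x ∈ X, x ∈ F.cut u₁ u₂ → x ∈ F.cut v₁ v₂ := fun x hx hc =>
    ((Set.ext_iff.1 hab x).1 ⟨hXball x hx, hc⟩).2
  have hbc' : ∀ x ∈ X, x ∈ F.cut v₁ v₂ → x ∈ F.cut w₁ w₂ := fun x hx hc =>
    ((Set.ext_iff.1 hbc x).1 ⟨hXball x hx, hc⟩).2
  have dPQ' : ∀ x ∈ P, x ∉ Q := fun _ hx => Set.disjoint_left.1 dPQ hx
  have dPX' : ∀ x ∈ P, x ∉ X := fun _ hx => Set.disjoint_left.1 dPX hx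
  have dXQ' : ∀ x ∈ X, x ∉ Q := fun _ hx => Set.disjoint_left.1 dXQ hx
  have fin : (F.cut v₁ v₂).Finite := hH.finite.subset (F.cut_subset _ _)
  have parts : ∀ {S : Set α}, S ⊆ H.vertexSet → S = S ∩ P ∪ S ∩ X ∪ S ∩ Q := fun {S} hS =>
    eq_parts hV.ge hS
  refine ciSup_mono (Set.finite_range _).bddAbove fun u => ?_
  rw [ElimForest.bag_eq_cut hH _ u.2, ElimForest.bag_eq_cut hH _ u.2]
  change f H (h.swap.cut u u) ≤ _
  by_cases c1 : F.Anc u₂ u ∧ F.Anc u v₁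
  · obtain ⟨e1, e2, e3, e4, e5, e6, e7⟩ :=
      h.swap_cut_upper hA hB hPQ dPQ' dPX' dXQ' hab' hbc' c1.1 c1.2
    have ex := hf.exchange hH (A := F.cut u u ∩ P) (A' := F.cut v₁ v₂ ∩ P)
      (B := F.cut v₁ v₂ ∩ Q) (B' := F.cut w₁ w₂ ∩ Q) (Y := F.cut v₁ v₂ ∩ X) hP hQ hX hPQ dPQ dXQ
      Set.inter_subset_right Set.inter_subset_right Set.inter_subset_right Set.inter_subset_right
      Set.inter_subset_right ((Set.ncard_le_ncard Set.inter_subset_left fin).trans hN)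
      (by rw [← Set.inter_assoc, ← Set.inter_assoc, hbc])
    have r1 : F.cut u u ∩ P ∪ F.cut v₁ v₂ ∩ X ∪ F.cut v₁ v₂ ∩ Q = F.cut u u := by
      rw [← e2, ← e4]; exact (parts (F.cut_subset _ _)).symm
    have r2 : F.cut v₁ v₂ ∩ P ∪ F.cut v₁ v₂ ∩ X ∪ F.cut w₁ w₂ ∩ Q = F.cut w₁ w₂ := by
      rw [e6, e7]; exact (parts (F.cut_subset _ _)).symm
    have r3 : F.cut u u ∩ P ∪ F.cut v₁ v₂ ∩ X ∪ F.cut w₁ w₂ ∩ Q = h.swap.cut u u := by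
      rw [← e5, ← e3, e1]; exact (parts (h.swap.cut_subset _ _)).symm
    rw [r1, r2, r3, ← parts (F.cut_subset v₁ v₂)] at ex
    -- At this point `ex` says that the old bag plus the separator below weighs as much as the new
    -- bag plus the middle separator.
    refine le_of_add_le_add_right (a := f H (F.cut v₁ v₂)) ?_
    rw [← ex]
    gcongr
  by_cases c2 : F.Anc v₂ u ∧ F.Anc u w₁
  · obtain ⟨e1, e2, e3, e4, e5, e6, e7⟩ :=
      h.swap_cut_lower hA hB hPQ dPQ' dPX' dXQ' hab' hbc' c2.1 c2.2
    have ex := hf.exchange hH (A := F.cut u u ∩ Q) (A' := F.cut v₁ v₂ ∩ Q)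
      (B := F.cut v₁ v₂ ∩ P) (B' := F.cut u₁ u₂ ∩ P) (Y := F.cut v₁ v₂ ∩ X) hQ hP hX
      (fun x hx y hy h' => hPQ y hy x hx h'.symm) dPQ.symm dPX.symm
      Set.inter_subset_right Set.inter_subset_right Set.inter_subset_right Set.inter_subset_right
      Set.inter_subset_right ((Set.ncard_le_ncard Set.inter_subset_left fin).trans hN)
      (by rw [← Set.inter_assoc, ← Set.inter_assoc, hab])
    have parts' : ∀ {S : Set α}, S ⊆ H.vertexSet → S = S ∩ Q ∪ S ∩ X ∪ S ∩ P := fun {S} hS => by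
      refine eq_parts ?_ hS
      rw [← hV]
      rintro x ((hx | hx) | hx)
      · exact Or.inr hx
      · exact Or.inl (Or.inr hx)
      · exact Or.inl (Or.inl hx)
    have r1 : F.cut u u ∩ Q ∪ F.cut v₁ v₂ ∩ X ∪ F.cut v₁ v₂ ∩ P = F.cut u u := by
      rw [← e2, ← e4]; exact (parts' (F.cut_subset _ _)).symm
    have r2 : F.cut v₁ v₂ ∩ Q ∪ F.cut v₁ v₂ ∩ X ∪ F.cut u₁ u₂ ∩ P = F.cut u₁ u₂ := by
      rw [e6, e7]; exact (parts' (F.cut_subset _ _)).symm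
    have r3 : F.cut u u ∩ Q ∪ F.cut v₁ v₂ ∩ X ∪ F.cut u₁ u₂ ∩ P = h.swap.cut u u := by
      rw [← e5, ← e3, e1]; exact (parts' (h.swap.cut_subset _ _)).symm
    rw [r1, r2, r3, ← parts' (F.cut_subset v₁ v₂)] at ex
    refine le_of_add_le_add_right (a := f H (F.cut v₁ v₂)) ?_
    rw [← ex]
    gcongr
  · rw [h.swap_cut_of_not_anc hA hB hPQ (fun h1 _ h2 => c1 ⟨h1, h2⟩)
      (fun h1 _ h2 => c2 ⟨h1, h2⟩)]

end RootedForest.Consecutive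

end HWidth

namespace HWidth

/-! ### Long sequences -/

theorem card_le_of_injOn_Icc {β : Type*} {a : ℕ → β} {V : Set β} (hV : V.Finite) {i j : ℕ}
    (ha : ∀ l ∈ Set.Icc i j, a l ∈ V) (hinj : Set.InjOn a (Set.Icc i j)) :
    j + 1 - i ≤ V.ncard := by
  have h := Set.ncard_le_ncard (s := a '' Set.Icc i j) (t := V)
    (by rintro _ ⟨l, hl, rfl⟩; exact ha l hl) hV
  rwa [hinj.ncard_image, ← Finset.coe_Icc, Set.ncard_coe_finset, Nat.card_Icc] at h

/-- A sequence that is long compared to its number of values has a weak local maximum. -/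
theorem exists_local_max {β : Type*} [LinearOrder β] {a : ℕ → β} {V : Set β} (hV : V.Finite)
    {T : ℕ} (hT : V.ncard ≤ T) {j₀ : ℕ} (ha : ∀ j ∈ Set.Icc j₀ (j₀ + 2 * T), a j ∈ V) :
    ∃ j, j₀ ≤ j ∧ j + 2 ≤ j₀ + 2 * T ∧ a j ≤ a (j + 1) ∧ a (j + 2) ≤ a (j + 1) := by
  by_contra! hcon
  -- The first $T+1$ terms cannot all strictly decrease, so there is an early ascent. Without a
  -- local maximum the sequence increases strictly from there on, and at least $T+1$ terms remain.
  have hup : ∃ j, j₀ ≤ j ∧ j < j₀ + T ∧ a j ≤ a (j + 1) := by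
    by_contra! h
    have hanti : StrictAntiOn a (Set.Icc j₀ (j₀ + T)) := by
      refine strictAntiOn_of_succ_lt Set.ordConnected_Icc fun j _ hj hj' => ?_
      exact h j hj.1 (Nat.lt_of_succ_le hj'.2)
    have := card_le_of_injOn_Icc hV (fun l hl => ha l ⟨hl.1, by have := hl.2; omega⟩) hanti.injOn
    omega
  obtain ⟨j, hj, hjT, hle⟩ := hup
  have hstep : ∀ l, j + 1 + l < j₀ + 2 * T → a (j + 1 + l) < a (j + 1 + l + 1) := by
    intro l
    induction l with
    | zero => exact fun hl => hcon j hj (by omega) hle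
    | succ l ih => exact fun hl => hcon (j + 1 + l) (by omega) (by omega) (ih (by omega)).le
  have hmono : StrictMonoOn a (Set.Icc (j + 1) (j₀ + 2 * T)) := by
    refine strictMonoOn_of_lt_succ Set.ordConnected_Icc fun l _ hl hl' => ?_
    obtain ⟨m, rfl⟩ := Nat.exists_eq_add_of_le hl.1
    exact hstep m (Nat.lt_of_succ_le hl'.2)
  have := card_le_of_injOn_Icc hV (fun l hl => ha l ⟨by have := hl.1; omega, hl.2⟩) hmono.injOn
  omega

/-- A sequence of subsets of a small set in which every element occurs during an interval is
constant on a long interval. -/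
theorem exists_constant_block {α : Type*} {Q : ℕ → Set α} {D : Set α} (hD : D.Finite) {M L K : ℕ}
    (hM : D.ncard ≤ M) (hK : (2 * M + 1) * L ≤ K) (hQ : ∀ j, Q j ⊆ D)
    (hconv : ∀ i j k, i ≤ j → j ≤ k → k < K → ∀ x, x ∈ Q i → x ∈ Q k → x ∈ Q j) :
    ∃ j₀, j₀ + L ≤ K ∧ ∀ j, j₀ ≤ j → j + 1 < j₀ + L → Q j = Q (j + 1) := by
  by_contra! hcon
  have hblock : ∀ m, m ≤ 2 * M → m * L + L ≤ K := fun m hm => by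
    calc m * L + L = (m + 1) * L := by ring
      _ ≤ (2 * M + 1) * L := Nat.mul_le_mul_right _ (by omega)
      _ ≤ K := hK
  -- One change is picked in each of $2M+1$ disjoint blocks of length `L`; the value for larger `m`
  -- is irrelevant.
  have hex : ∀ m, ∃ j, m ≤ 2 * M → m * L ≤ j ∧ j + 1 < m * L + L ∧ Q j ≠ Q (j + 1) := by
    intro m
    by_cases hm : m ≤ 2 * M
    · obtain ⟨j, hj⟩ := hcon (m * L) (hblock m hm)
      exact ⟨j, fun _ => hj⟩
    · exact ⟨0, fun h => absurd h hm⟩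
  choose g hg using hex
  have hsucc : ∀ m m', m < m' → m' ≤ 2 * M → g m + 1 < g m' ∧ g m' + 1 < K := by
    intro m m' hmm hm'
    have h1 := hg m (by omega)
    have h2 := hg m' hm'
    have h3 := hblock m' hm'
    have h4 : m * L + L ≤ m' * L := by
      calc m * L + L = (m + 1) * L := by ring
        _ ≤ m' * L := Nat.mul_le_mul_right _ hmm
    omega
  -- Label each change by an element and by whether it leaves (`true`) or enters (`false`). By
  -- convexity no element leaves twice or enters twice, but there are at most $2M$ labels.
  have hd : ∀ m, ∃ d : α × Bool, m ≤ 2 * M → d.1 ∈ D ∧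
      (d.2 = true → d.1 ∈ Q (g m) ∧ d.1 ∉ Q (g m + 1)) ∧
      (d.2 = false → d.1 ∉ Q (g m) ∧ d.1 ∈ Q (g m + 1)) := by
    intro m
    have hne := hg 0 (Nat.zero_le _)
    by_cases hm : m ≤ 2 * M
    · have hne := (hg m hm).2.2
      rw [Ne, Set.ext_iff, not_forall] at hne
      obtain ⟨x, hx⟩ := hne
      by_cases hxm : x ∈ Q (g m)
      · exact ⟨(x, true), fun _ => ⟨hQ _ hxm, fun _ => ⟨hxm, by tauto⟩, by simp⟩⟩
      · have : x ∈ Q (g m + 1) := by tauto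
        exact ⟨(x, false), fun _ => ⟨hQ _ this, by simp, fun _ => ⟨hxm, this⟩⟩⟩
    · have hne := hne.2.2
      rw [Ne, Set.ext_iff, not_forall] at hne
      obtain ⟨x, -⟩ := hne
      exact ⟨(x, true), fun h => absurd h hm⟩
  choose d hd using hd
  have hlt : ∀ m m', m < m' → m' ≤ 2 * M → d m ≠ d m' := by
    intro m m' hmm hm' heq
    obtain ⟨h1, h2⟩ := hsucc m m' hmm hm'
    obtain ⟨-, t1, f1⟩ := hd m (by omega)
    obtain ⟨-, t2, f2⟩ := hd m' hm'
    rw [heq] at t1 f1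
    cases hb : (d m').2
    · exact (f2 hb).1 (hconv (g m + 1) (g m') (g m' + 1) h1.le (by omega) h2 _ (f1 hb).2 (f2 hb).2)
    · exact (t1 hb).2 (hconv (g m) (g m + 1) (g m') (by omega) h1.le (by omega) _ (t1 hb).1
        (t2 hb).1)
  have hinj : Set.InjOn d (Set.Icc 0 (2 * M)) := by
    intro m hm m' hm' heq
    rcases lt_trichotomy m m' with h | h | h
    · exact absurd heq (hlt m m' h hm'.2)
    · exact h
    · exact absurd heq.symm (hlt m' m h hm.2)
  have := card_le_of_injOn_Icc (V := D ×ˢ (Set.univ : Set Bool)) (hD.prod Set.finite_univ)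
    (fun m hm => ⟨(hd m hm.2).1, Set.mem_univ _⟩) hinj
  rw [Set.ncard_prod, Set.ncard_univ, Nat.card_eq_fintype_card, Fintype.card_bool] at this
  omega

/-! ### The number of widths of small sets -/

variable {α : Type u} {H : Hypergraph α}

/-- An upper bound for the number of hypergraphs with at most `N` vertices up to isomorphism. -/
def typeCount (N : ℕ) : ℕ := ∑ n ∈ Finset.range (N + 1), 2 ^ 2 ^ n

theorem typeCount_mono : Monotone typeCount := fun _ _ h =>
  Finset.sum_le_sum_of_subset (Finset.range_mono (Nat.succ_le_succ h))

/-- Invariant locality makes the width of $U$ depend only on $H[U]$ up to isomorphism. Numbering the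
$n$ vertices of $U$ encodes $H[U]$ as one of the $2^{2^n}$ families of subsets of `Fin n`. -/
theorem WeaklyManageable.ncard_values_le {f : WidthFunction.{u}} (hf : WeaklyManageable f)
    (hH : Proper H) (N : ℕ) :
    {v | ∃ U ⊆ H.vertexSet, U.ncard ≤ N ∧ f H U = v}.Finite ∧
      {v | ∃ U ⊆ H.vertexSet, U.ncard ≤ N ∧ f H U = v}.ncard ≤ typeCount N := by
  classical
  set V := {v | ∃ U ⊆ H.vertexSet, U.ncard ≤ N ∧ f H U = v} with hV
  have hU : ∀ v : V, ∃ U ⊆ H.vertexSet, U.ncard ≤ N ∧ f H U = v := fun v => v.2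
  choose U hUH hUN hUf using hU
  have e : ∀ v : V, U v ≃ Fin (U v).ncard := fun v =>
    have : Finite (U v) := hH.finite.subset (hUH v)
    Finite.equivFinOfCardEq (Nat.card_coe_set_eq _)
  let code : V → Σ n : Fin (N + 1), Set (Set (Fin n)) := fun v =>
    ⟨⟨(U v).ncard, Nat.lt_succ_of_le (hUN v)⟩,
      {s | (Subtype.val '' ((e v).symm '' s)) ∈ (induce H (U v)).edgeSet}⟩
  have key : ∀ (v w : V) (n : ℕ) (a : U v ≃ Fin n) (b : U w ≃ Fin n),
      {s | (Subtype.val '' (a.symm '' s)) ∈ (induce H (U v)).edgeSet} =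
        {s | (Subtype.val '' (b.symm '' s)) ∈ (induce H (U w)).edgeSet} → v = w := by
    intro v w n a b hab
    apply Subtype.ext
    rw [← hUf v, ← hUf w]
    refine hf.invariant_locality H H hH hH _ (hUH v) _ (hUH w) ⟨a.trans b.symm,
      fun (s : Set (U v)) => ?_⟩
    have h1 : a.symm '' (a '' s) = s := a.symm_image_image s
    have h2 : b.symm '' (a '' s) = (a.trans b.symm) '' s := by rw [Equiv.coe_trans, Set.image_comp]
    have h3 := Set.ext_iff.1 hab (a '' s)
    rw [Set.mem_ofPred_eq, Set.mem_ofPred_eq, h1, h2] at h3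
    exact h3
  have hcode : Function.Injective code := by
    intro v w hvw
    have h1 : (U v).ncard = (U w).ncard := congrArg (fun c => (c.1 : ℕ)) hvw
    -- The sizes are made variables so that their equality can be substituted in the dependent
    -- pairs.
    have h2 : ∀ (n m : Fin (N + 1)) (h : n = m) (a : U v ≃ Fin n) (b : U w ≃ Fin m),
        (⟨n, {s | (Subtype.val '' (a.symm '' s)) ∈ (induce H (U v)).edgeSet}⟩ :
          Σ n : Fin (N + 1), Set (Set (Fin n))) =
        ⟨m, {s | (Subtype.val '' (b.symm '' s)) ∈ (induce H (U w)).edgeSet}⟩ → v = w := by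
      rintro n m rfl a b h
      exact key v w n a b (eq_of_heq (Sigma.mk.inj h).2)
    exact h2 ⟨_, Nat.lt_succ_of_le (hUN v)⟩ ⟨_, Nat.lt_succ_of_le (hUN w)⟩ (Fin.ext h1) (e v) (e w)
      hvw
  have hfin : Finite V := Finite.of_injective code hcode
  refine ⟨hfin, ?_⟩
  rw [← Nat.card_coe_set_eq]
  refine (Nat.card_le_card_of_injective code hcode).trans ?_
  rw [Nat.card_eq_fintype_card, Fintype.card_sigma]
  simp only [Fintype.card_set, Fintype.card_fin]
  rw [Fin.sum_univ_eq_sum_range (fun n => 2 ^ 2 ^ n) (N + 1)]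
  exact le_rfl

/-! ### Sizes of balls and bags -/

theorem Proper.finite_edgeSet (hH : Proper H) : H.edgeSet.Finite :=
  hH.finite.finite_subsets.subset fun _ he => H.subset_vertexSet_of_mem_edgeSet' he

theorem Proper.ncard_le_rank (hH : Proper H) {e : Set α} (he : e ∈ H.edgeSet) :
    e.ncard ≤ rank H := by
  refine le_csSup ((hH.finite_edgeSet.image Set.ncard).subset ?_).bddAbove ⟨e, he, rfl⟩
  rintro n ⟨e, he, rfl⟩
  exact ⟨e, he, rfl⟩

theorem Proper.ncard_edges_le (hH : Proper H) {v : α} (hv : v ∈ H.vertexSet) :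
    {e ∈ H.edgeSet | v ∈ e}.ncard ≤ maxDegree H := by
  refine le_csSup ((hH.finite.image fun v => {e ∈ H.edgeSet | v ∈ e}.ncard).subset ?_).bddAbove
    ⟨v, hv, rfl⟩
  rintro n ⟨v, hv, rfl⟩
  exact ⟨v, hv, rfl⟩

theorem ncard_biUnion_le_mul {ι : Type*} {s : Set ι} (hs : s.Finite) {t : ι → Set α} {c : ℕ}
    (hc : ∀ i ∈ s, (t i).ncard ≤ c) : (⋃ i ∈ s, t i).ncard ≤ s.ncard * c := by
  induction s, hs using Set.Finite.induction_on with
  | empty => simp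
  | @insert a s ha hs ih =>
    rw [Set.biUnion_insert, Set.ncard_insert_of_notMem ha hs]
    refine (Set.ncard_union_le _ _).trans ?_
    have h1 := hc a (Set.mem_insert _ _)
    have h2 := ih fun i hi => hc i (Set.mem_insert_of_mem _ hi)
    calc _ ≤ c + s.ncard * c := Nat.add_le_add h1 h2
      _ = (s.ncard + 1) * c := by ring

theorem Proper.ncard_adj_le (hH : Proper H) {x : α} (hx : x ∈ H.vertexSet) :
    {y | H.Adj x y}.ncard ≤ maxDegree H * rank H := by
  have hE : {e ∈ H.edgeSet | x ∈ e}.Finite := hH.finite_edgeSet.subset fun _ h => h.1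
  have : {y | H.Adj x y} = ⋃ e ∈ {e ∈ H.edgeSet | x ∈ e}, e := by
    ext y
    simp [Hypergraph.Adj, and_assoc]
  rw [this]
  exact (ncard_biUnion_le_mul hE fun e he => hH.ncard_le_rank he.1).trans
    (Nat.mul_le_mul_right _ (hH.ncard_edges_le hx))

theorem Proper.ncard_ball_le (hH : Proper H) {X : Set α} (hX : X ⊆ H.vertexSet) (t : ℕ) :
    (ball H X t).ncard ≤ X.ncard * (1 + maxDegree H * rank H) ^ t := by
  induction t with
  | zero => simp [ball]
  | succ t ih =>
    have hfin := hH.finite.subset (ball_subset hX t)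
    have h : {y | ∃ x ∈ ball H X t, H.Adj x y} = ⋃ x ∈ ball H X t, {y | H.Adj x y} := by
      ext y; simp
    have h' := ncard_biUnion_le_mul hfin (t := fun x => {y | H.Adj x y}) fun x hx =>
      hH.ncard_adj_le (ball_subset hX t hx)
    rw [← h] at h'
    calc (ball H X (t + 1)).ncard
        ≤ (ball H X t).ncard + (ball H X t).ncard * (maxDegree H * rank H) :=
          (Set.ncard_union_le _ _).trans (Nat.add_le_add_left h' _)
      _ = (ball H X t).ncard * (1 + maxDegree H * rank H) := by ring
      _ ≤ X.ncard * (1 + maxDegree H * rank H) ^ t * (1 + maxDegree H * rank H) :=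
          Nat.mul_le_mul_right _ ih
      _ = _ := by ring

/-- The bound on the size of sets of bounded width can be chosen to be monotone. -/
theorem WeaklyManageable.exists_monotone_bound {f : WidthFunction.{u}} (hf : WeaklyManageable f) :
    ∃ β : ℝ≥0 → ℕ → ℕ, (∀ k k' r r', k ≤ k' → r ≤ r' → β k r ≤ β k' r') ∧
      ∀ (k : ℝ≥0) ⦃α : Type u⦄ (H : Hypergraph α), Proper H →
        ∀ U ⊆ H.vertexSet, f H U ≤ k → U.ncard ≤ β k (rank H) := by
  obtain ⟨β, hβ⟩ := hf.bounded_size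
  let S : ℝ≥0 → ℕ → Set ℕ := fun k r => {n | ∃ (α : Type u) (H : Hypergraph α) (U : Set α),
    Proper H ∧ U ⊆ H.vertexSet ∧ f H U ≤ k ∧ rank H ≤ r ∧ n = U.ncard}
  have hS : ∀ k r, BddAbove (S k r) := by
    refine fun k r => ⟨∑ r' ∈ Finset.range (r + 1), β k r', ?_⟩
    rintro n ⟨α, H, U, hH, hU, hk, hr, rfl⟩
    exact (hβ k H hH U hU hk).trans (Finset.single_le_sum (f := β k) (fun _ _ => Nat.zero_le _)
      (Finset.mem_range.2 (Nat.lt_succ_of_le hr)))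
  refine ⟨fun k r => sSup (S k r), fun k k' r r' hk hr => ?_, fun k α H hH U hU hk => ?_⟩
  · rcases (S k r).eq_empty_or_nonempty with h | h
    · simp [h]
    · refine csSup_le_csSup (hS k' r') h ?_
      rintro n ⟨α, H, U, hH, hU, hfk, hfr, rfl⟩
      exact ⟨α, H, U, hH, hU, hfk.trans hk, hfr.trans hr, rfl⟩
  · exact le_csSup (hS k _) ⟨α, H, U, hH, hU, hk, le_rfl, rfl⟩

end HWidth

namespace HWidth

variable {α : Type u}

/-! ### Vertical paths -/

namespace RootedForest

variable {S : Set α} {F : RootedForest S}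

/-- `s 0, …, s n` is a path in `F`, directed away from the root. -/
def IsPath (F : RootedForest S) (s : ℕ → α) (n : ℕ) : Prop :=
  ∀ m < n, F.parent (s (m + 1)) = some (s m)

theorem Anc.exists_isPath {x y : α} (h : F.Anc x y) :
    ∃ (s : ℕ → α) (n : ℕ), F.IsPath s n ∧ s 0 = x ∧ s n = y := by
  induction h with
  | refl => exact ⟨fun _ => x, 0, fun m hm => absurd hm (Nat.not_lt_zero m), Eq.refl _, Eq.refl _⟩
  | @tail b c _ hbc ih =>
    obtain ⟨s, n, hs, h0, hn⟩ := ih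
    refine ⟨fun k => if k ≤ n then s k else c, n + 1, fun m hm => ?_, by simpa using h0, by simp⟩
    rcases Nat.lt_succ_iff_lt_or_eq.1 hm with h | rfl
    · simpa [h.le, Nat.succ_le_of_lt h] using hs m h
    · simpa [hn] using hbc

namespace IsPath

variable {s : ℕ → α} {n : ℕ}

theorem anc (hs : F.IsPath s n) {l m : ℕ} (hlm : l ≤ m) (hm : m ≤ n) : F.Anc (s l) (s m) := by
  induction m, hlm using Nat.le_induction with
  | base => exact .rfl
  | succ m _ ih => exact (ih (by omega)).of_parent (hs m (by omega))

theorem anc_iff (hs : F.IsPath s n) {l m : ℕ} (hl : l ≤ n) (hm : m ≤ n) :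
    F.Anc (s l) (s m) ↔ l ≤ m := by
  refine ⟨fun h => ?_, fun h => hs.anc h hm⟩
  by_contra! hlt
  obtain ⟨k, rfl⟩ := Nat.exists_eq_add_of_lt hlt
  exact Anc.not_of_parent (hs (m + k) (by omega)) (h.trans (hs.anc (by omega) (by omega)))

theorem exists_eq (hs : F.IsPath s n) {v : α} (h : F.Anc (s 0) v) {m : ℕ} (hm : m ≤ n)
    (h' : F.Anc v (s m)) : ∃ l ≤ m, v = s l := by
  induction m with
  | zero => exact ⟨0, le_rfl, h'.antisymm h⟩
  | succ m ih =>
    by_cases hv : v = s (m + 1)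
    · exact ⟨m + 1, le_rfl, hv⟩
    · obtain ⟨l, hl, rfl⟩ := ih (by omega) (h'.anc_parent hv (hs m (by omega)))
      exact ⟨l, by omega, rfl⟩

end IsPath

end RootedForest

/-! ### Colour intervals -/

variable {H : Hypergraph α} {C : ColourPartition H}

/-- The vertices of the path `s 0, …, s n` that are joined to `s m` by a subpath without a change
of colour. -/
def run (C : ColourPartition H) (s : ℕ → α) (n m : ℕ) : Set α :=
  {v | ∃ l ≤ n, v = s l ∧ ∀ t, min l m ≤ t → t ≤ max l m → (s t ∈ C.red ↔ s m ∈ C.red)}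

open Classical in
/-- The positions after which the colour changes. -/
noncomputable def changes (C : ColourPartition H) (s : ℕ → α) (n : ℕ) : Finset ℕ :=
  {m ∈ Finset.range n | ¬ (s m ∈ C.red ↔ s (m + 1) ∈ C.red)}

section Intervals

variable {F : RootedForest H.vertexSet} {U : F.ContextFactor} {s : ℕ → α} {n : ℕ}

theorem mem_run_self {m : ℕ} (hm : m ≤ n) : s m ∈ run C s n m :=
  ⟨m, hm, rfl, fun t h1 h2 => by
    have : t = m := by simp at h1 h2; omega
    rw [this]⟩

theorem spine_eq (hs : F.IsPath s n) (h0 : s 0 = U.rt) (hn : s n = U.pr) {v : α} :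
    v ∈ U.spine ↔ ∃ m ≤ n, v = s m := by
  constructor
  · rintro ⟨h1, h2⟩
    exact hs.exists_eq (h0 ▸ h1) le_rfl (hn ▸ h2)
  · rintro ⟨m, hm, rfl⟩
    exact ⟨h0 ▸ hs.anc (Nat.zero_le m) hm, hn ▸ hs.anc hm le_rfl⟩

/-- A monochromatic subpath through `s m` cannot pass a colour change, which makes the run of `m`
the largest such subpath. -/
theorem subset_run (hs : F.IsPath s n) (h0 : s 0 = U.rt) (hn : s n = U.pr) {Q : Set α}
    (hQ : F.IsSubpath U.spine Q) (hC : C.Monochromatic Q) {m : ℕ} (hm : m ≤ n) (hmQ : s m ∈ Q) :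
    Q ⊆ run C s n m := by
  intro v hv
  obtain ⟨l, hl, rfl⟩ := (spine_eq hs h0 hn).1 (hQ.1 hv)
  refine ⟨l, hl, rfl, fun t h1 h2 => ?_⟩
  have htn : t ≤ n := by omega
  have htQ : s t ∈ Q := by
    have hsp : s t ∈ U.spine := (spine_eq hs h0 hn).2 ⟨t, htn, rfl⟩
    rcases le_total l m with h | h
    · exact hQ.2.2 _ hv _ hmQ _ hsp (hs.anc (by omega) htn) (hs.anc (by omega) hm)
    · exact hQ.2.2 _ hmQ _ hv _ hsp (hs.anc (by omega) htn) (hs.anc (by omega) hl)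
  rcases hC with hC | hC
  · exact iff_of_true (hC htQ) (hC hmQ)
  · exact iff_of_false (fun h => Set.disjoint_left.1 C.disjoint_red_blue h (hC htQ))
      (fun h => Set.disjoint_left.1 C.disjoint_red_blue h (hC hmQ))

theorem run_mem_intervals (hs : F.IsPath s n) (h0 : s 0 = U.rt) (hn : s n = U.pr)
    (hcol : ∀ m ≤ n, s m ∈ C.red ∪ C.blue) {m : ℕ} (hm : m ≤ n) :
    run C s n m ∈ intervals C U := by
  refine ⟨⟨⟨?_, ⟨_, mem_run_self hm⟩, ?_⟩, ?_⟩, fun Q hQ hle =>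
    subset_run hs h0 hn hQ.1 hQ.2 hm (hle (mem_run_self hm))⟩
  · rintro _ ⟨l, hl, rfl, -⟩
    exact (spine_eq hs h0 hn).2 ⟨l, hl, rfl⟩
  · rintro _ ⟨i, hi, rfl, hi'⟩ _ ⟨j, hj, rfl, hj'⟩ c hc h1 h2
    obtain ⟨k, hk, rfl⟩ := (spine_eq hs h0 hn).1 hc
    rw [hs.anc_iff hi hk] at h1
    rw [hs.anc_iff hk hj] at h2
    refine ⟨k, hk, rfl, fun t ht ht' => ?_⟩
    rcases le_total m k with h | h
    · exact hj' t (by omega) (by omega)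
    · exact hi' t (by omega) (by omega)
  · by_cases hr : s m ∈ C.red
    · left
      rintro _ ⟨l, hl, rfl, h⟩
      exact (h l (min_le_left _ _) (le_max_left _ _)).2 hr
    · right
      rintro _ ⟨l, hl, rfl, h⟩
      exact (hcol l hl).resolve_left fun h' => hr ((h l (min_le_left _ _) (le_max_left _ _)).1 h')

theorem run_succ (hs : F.IsPath s n) (h0 : s 0 = U.rt) (hn : s n = U.pr)
    (hcol : ∀ m ≤ n, s m ∈ C.red ∪ C.blue) {m : ℕ} (hm : m < n)
    (h : s m ∈ C.red ↔ s (m + 1) ∈ C.red) : run C s n m = run C s n (m + 1) := by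
  have hI := run_mem_intervals hs h0 hn hcol hm.le
  have hmem : s (m + 1) ∈ run C s n m := by
    refine ⟨m + 1, hm, rfl, fun t h1 h2 => ?_⟩
    have : t = m ∨ t = m + 1 := by omega
    rcases this with rfl | rfl
    · rfl
    · exact h.symm
  have hle := subset_run hs h0 hn hI.1.1 hI.1.2 hm hmem
  exact hle.antisymm (hI.2 (run_mem_intervals hs h0 hn hcol hm).1 hle)

/-- Moving down the path within one colour does not alter the run, and the move ends at a colour
change or at `n`. -/
theorem exists_change_run_eq (hs : F.IsPath s n) (h0 : s 0 = U.rt) (hn : s n = U.pr)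
    (hcol : ∀ m ≤ n, s m ∈ C.red ∪ C.blue) {m : ℕ} (hm : m ≤ n) :
    ∃ m' ∈ insert n (changes C s n), run C s n m = run C s n m' := by
  induction hm using Nat.decreasingInduction with
  | self => exact ⟨n, Finset.mem_insert_self _ _, rfl⟩
  | of_succ m hm ih =>
    by_cases h : s m ∈ C.red ↔ s (m + 1) ∈ C.red
    · rw [run_succ hs h0 hn hcol hm h]
      exact ih
    · exact ⟨m, Finset.mem_insert_of_mem (by simp [changes, hm, h]), rfl⟩

theorem ncard_intervals_le (hs : F.IsPath s n) (h0 : s 0 = U.rt) (hn : s n = U.pr)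
    (hcol : ∀ m ≤ n, s m ∈ C.red ∪ C.blue) :
    (intervals C U).ncard ≤ (changes C s n).card + 1 := by
  have hsub : intervals C U ⊆ run C s n '' (insert n (changes C s n) : Finset ℕ) := by
    intro Q hQ
    obtain ⟨v, hv⟩ := hQ.1.1.2.1
    obtain ⟨m, hm, rfl⟩ := (spine_eq hs h0 hn).1 (hQ.1.1.1 hv)
    have hle := subset_run hs h0 hn hQ.1.1 hQ.1.2 hm hv
    obtain ⟨m', hm', h⟩ := exists_change_run_eq hs h0 hn hcol hm
    exact ⟨m', hm', h ▸ (hQ.2 (run_mem_intervals hs h0 hn hcol hm).1 hle).antisymm hle⟩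
  refine (Set.ncard_le_ncard hsub ((Finset.finite_toSet _).image _)).trans ?_
  refine (Set.ncard_image_le (Finset.finite_toSet _)).trans ?_
  rw [Set.ncard_coe_finset]
  exact Finset.card_insert_le _ _

theorem mem_changes {m : ℕ} :
    m ∈ changes C s n ↔ m < n ∧ ¬ (s m ∈ C.red ↔ s (m + 1) ∈ C.red) := by
  simp [changes]

theorem isLast_run (hs : F.IsPath s n) {m : ℕ} (hm : m ∈ changes C s n) :
    F.IsLast (run C s n m) (s m) := by
  rw [mem_changes] at hm
  refine ⟨mem_run_self hm.1.le, ?_⟩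
  rintro _ ⟨l, hl, rfl, h⟩
  refine hs.anc ?_ hm.1.le
  by_contra! hlt
  exact hm.2 (h (m + 1) (by omega) (by omega)).symm

theorem isFirst_run (hs : F.IsPath s n) {a m : ℕ} (ha : a ∈ changes C s n) (ham : a < m)
    (hconst : ∀ t, a < t → t ≤ m → (s t ∈ C.red ↔ s m ∈ C.red)) :
    F.IsFirst (run C s n m) (s (a + 1)) := by
  rw [mem_changes] at ha
  refine ⟨⟨a + 1, ha.1, rfl, fun t h1 h2 => hconst t (by omega) (by omega)⟩, ?_⟩
  rintro _ ⟨l, hl, rfl, h⟩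
  refine hs.anc ?_ hl
  by_contra! hlt
  exact ha.2 ((h a (by omega) (by omega)).trans (h (a + 1) (by omega) (by omega)).symm)

theorem colour_const {a b : ℕ} (hb : b ≤ n) (hno : ∀ t, a < t → t < b → t ∉ changes C s n)
    {t : ℕ} (hat : a < t) (htb : t ≤ b) : s t ∈ C.red ↔ s b ∈ C.red := by
  induction htb using Nat.decreasingInduction with
  | self => exact Iff.rfl
  | of_succ t ht ih =>
    have := hno t hat ht
    rw [mem_changes, not_and, not_not] at this
    exact (this (by omega)).trans (ih (by omega))

end Intervals

/-! ### Reduced elimination forests respect the colours -/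

theorem ColourPartition.red_iff_of_adj {x y : α} (hx : x ∈ C.red ∪ C.blue)
    (hy : y ∈ C.red ∪ C.blue) (h : H.Adj x y) : x ∈ C.red ↔ y ∈ C.red := by
  obtain ⟨e, he, hxe, hye⟩ := h
  have hmix := C.no_mixed_edge e he
  constructor
  · intro hr
    exact hy.resolve_right fun hb => hmix ⟨⟨x, hxe, hr⟩, ⟨y, hye, hb⟩⟩
  · intro hr
    exact hx.resolve_right fun hb => hmix ⟨⟨y, hye, hr⟩, ⟨x, hxe, hb⟩⟩

/-- A tree factor of a reduced elimination forest without vertices of `X` has one colour. -/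
theorem ElimForest.Reduced.red_iff (hH : Proper H) {F : ElimForest H} (hF : F.Reduced) {z : α}
    (hz : z ∈ H.vertexSet) (hsub : F.treeFactor z ⊆ C.red ∪ C.blue) {w : α} (hw : F.Anc z w) :
    w ∈ C.red ↔ z ∈ C.red := by
  induction hcard : (F.treeFactor z).ncard using Nat.strong_induction_on generalizing z w with
  | _ k ih =>
    rcases Relation.ReflTransGen.cases_head hw with rfl | ⟨y, hy, hyw⟩
    · rfl
    have hyV : y ∈ H.vertexSet := (F.mem_of_parent _ _ hy).2
    have hss : F.treeFactor y ⊆ F.treeFactor z := fun v hv =>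
      (RootedForest.anc_of_parent hy).trans hv
    have hlt : (F.treeFactor y).ncard < k := by
      rw [← hcard]
      refine Set.ncard_lt_ncard ⟨hss, fun h => ?_⟩ (hH.finite.subset fun v hv => hv.mem_right hz)
      exact RootedForest.Anc.not_of_parent hy (h RootedForest.Anc.rfl)
    have key : ∀ {v}, F.Anc y v → (v ∈ C.red ↔ y ∈ C.red) := fun hv =>
      ih _ hlt hyV (hss.trans hsub) hv rfl
    -- Reducedness gives `z` a neighbour in the subtree of its child, which transfers the colour of
    -- that subtree to `z`.
    obtain ⟨v, hv, hadj⟩ := hF z y hy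
    exact (key hyw).trans ((key hv).symm.trans
      (ColourPartition.red_iff_of_adj (hsub (hss hv)) (hsub RootedForest.Anc.rfl) hadj.symm))

/-- A vertex of a context factor without vertices of `X` has the colour of the spine vertex to
which it is attached. -/
theorem ElimForest.Reduced.red_iff_of_between (hH : Proper H) {F : ElimForest H} (hF : F.Reduced)
    {U : F.ContextFactor} (hU : U.carrier ⊆ C.red ∪ C.blue) {s : ℕ → α} {n : ℕ}
    (hs : F.IsPath s n) (h0 : s 0 = U.rt) (hn : s n = U.pr) {a b : ℕ} (hab : a ≤ b) (hb : b < n)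
    (hconst : ∀ t, a ≤ t → t ≤ b → (s t ∈ C.red ↔ s b ∈ C.red)) {x : α}
    (hx : F.Anc (s a) x) (hx' : ¬ F.Anc (s (b + 1)) x) :
    x ∈ C.red ∪ C.blue ∧ (x ∈ C.red ↔ s b ∈ C.red) := by
  have hpr : ∀ w ∈ U.appendices, F.Anc (s (b + 1)) w := fun w hw =>
    (hn ▸ hs.anc (by omega) le_rfl : F.Anc (s (b + 1)) U.pr).of_parent (U.parent_appendices w hw)
  have hrt : F.Anc U.rt (s a) := h0 ▸ hs.anc (Nat.zero_le a) (by omega)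
  have hcarrier : ∀ {v}, F.Anc (s a) v → ¬ F.Anc (s (b + 1)) v → v ∈ C.red ∪ C.blue := by
    intro v hv hv'
    refine hU ⟨hrt.trans hv, ?_⟩
    simp only [Set.mem_iUnion, not_exists]
    exact fun w hw hwv => hv' ((hpr w hw).trans hwv)
  refine ⟨hcarrier hx hx', ?_⟩
  induction hx with
  | refl => exact hconst a le_rfl hab
  | @tail y z hy hyz ih =>
    have hy' : ¬ F.Anc (s (b + 1)) y := fun h => hx' (h.of_parent hyz)
    have hz : F.Anc (s a) z := RootedForest.Anc.of_parent hy hyz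
    -- Either `z` is on the spine, or its subtree avoids the appendices and so lies in `U`. In the
    -- latter case the subtree has one colour, shared with `y` by reducedness.
    by_cases hzp : F.Anc z U.pr
    · obtain ⟨m, hm, rfl⟩ := hs.exists_eq (h0 ▸ hrt.trans hz) le_rfl (hn ▸ hzp)
      rw [hs.anc_iff (by omega) hm] at hz
      rw [hs.anc_iff (by omega) hm] at hx'
      exact hconst m hz (by omega)
    · have hsub : F.treeFactor z ⊆ C.red ∪ C.blue := by
        intro v hv
        refine hU ⟨hrt.trans (hz.trans hv), ?_⟩
        simp only [Set.mem_iUnion, not_exists]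
        intro w hw hwv
        rcases RootedForest.Anc.total hv hwv with h | h
        · by_cases hzw : z = w
          · exact hx' (hzw ▸ hpr w hw)
          · exact hzp (h.anc_parent hzw (U.parent_appendices w hw))
        · exact hx' ((hpr w hw).trans h)
      obtain ⟨v, hv, hadj⟩ := hF y z hyz
      have h1 := hF.red_iff hH (F.mem_of_parent _ _ hyz).2 hsub hv
      have h2 := ColourPartition.red_iff_of_adj (hcarrier hy hy') (hsub hv) hadj
      exact h1.symm.trans (h2.symm.trans (ih hy'))

end HWidth

/-! ### Finding a neutral swap. -/

namespace HWidth

variable {α : Type u} {H : Hypergraph α} {C : ColourPartition H}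

theorem _root_.Finset.exists_enumeration (s : Finset ℕ) :
    ∃ g : ℕ → ℕ, (∀ j < s.card, g j ∈ s) ∧ (∀ i j, i < j → j < s.card → g i < g j) ∧
      ∀ x ∈ s, ∃ j < s.card, g j = x := by
  refine ⟨fun j => if h : j < s.card then s.orderEmbOfFin rfl ⟨j, h⟩ else 0, fun j hj => ?_,
    fun i j hij hj => ?_, fun x hx => ?_⟩
  · simp [hj]
  · simp [hj, hij.trans hj, hij]
  · have : x ∈ Set.range (s.orderEmbOfFin rfl) := by simpa using hx
    obtain ⟨j, rfl⟩ := this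
    exact ⟨j, j.2, by simp⟩

theorem ColourPartition.adj_red_blue (C : ColourPartition H) {x y : α} (hx : x ∈ C.red)
    (hy : y ∈ C.blue) : ¬ H.Adj x y := by
  rintro ⟨e, he, hxe, hye⟩
  exact C.no_mixed_edge e he ⟨⟨x, hxe, hx⟩, ⟨y, hye, hy⟩⟩

section

variable {F : ElimForest H} {U : F.ContextFactor} {s : ℕ → α} {n N : ℕ}

/-- Three successive separators at colour changes that agree near `X`, the middle one having
locally maximal width, give a neutral swap. -/
theorem admitsNeutralSwap_of_local_max {f : WidthFunction.{u}} (hf : WeaklyManageable f)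
    (hH : Proper H) (hF : F.Reduced) (hU : U.carrier ⊆ C.red ∪ C.blue) (hs : F.IsPath s n)
    (h0 : s 0 = U.rt) (hn : s n = U.pr) (hcol : ∀ m ≤ n, s m ∈ C.red ∪ C.blue) {a b c : ℕ}
    (ha : a ∈ changes C s n) (hb : b ∈ changes C s n) (hc : c ∈ changes C s n) (hlt : a < b)
    (hlt' : b < c) (hno : ∀ t, a < t → t < b → t ∉ changes C s n)
    (hno' : ∀ t, b < t → t < c → t ∉ changes C s n)
    (hN : (F.cut (s b) (s (b + 1))).ncard ≤ N)
    (hab : ball H C.X (N + 1) ∩ F.cut (s a) (s (a + 1)) =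
      ball H C.X (N + 1) ∩ F.cut (s b) (s (b + 1)))
    (hbc : ball H C.X (N + 1) ∩ F.cut (s b) (s (b + 1)) =
      ball H C.X (N + 1) ∩ F.cut (s c) (s (c + 1)))
    (hle : f H (F.cut (s a) (s (a + 1))) ≤ f H (F.cut (s b) (s (b + 1))))
    (hle' : f H (F.cut (s c) (s (c + 1))) ≤ f H (F.cut (s b) (s (b + 1)))) :
    AdmitsNeutralSwap f C F U := by
  have han := (mem_changes.1 ha).1
  have hbn := (mem_changes.1 hb).1
  have hcn := (mem_changes.1 hc).1
  have kb : ∀ t, a < t → t ≤ b → (s t ∈ C.red ↔ s b ∈ C.red) := fun t h h' =>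
    colour_const hbn.le hno h h'
  have kc : ∀ t, b < t → t ≤ c → (s t ∈ C.red ↔ s c ∈ C.red) := fun t h h' =>
    colour_const hcn.le hno' h h'
  have hbc_col : ¬ (s b ∈ C.red ↔ s c ∈ C.red) := fun h =>
    (mem_changes.1 hb).2 (h.trans (kc (b + 1) (by omega) (by omega)).symm)
  have h : F.Consecutive (s a) (s (a + 1)) (s b) (s (b + 1)) (s c) (s (c + 1)) :=
    ⟨hs a han, hs b hbn, hs c hcn, hs.anc (by omega) hbn.le, hs.anc (by omega) hcn.le⟩
  have zA : ∀ x, F.Anc (s (a + 1)) x → ¬ F.Anc (s (b + 1)) x →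
      x ∈ C.red ∪ C.blue ∧ (x ∈ C.red ↔ s b ∈ C.red) := fun x hx hx' =>
    hF.red_iff_of_between hH hU hs h0 hn (by omega) hbn (fun t ht ht' => kb t (by omega) ht') hx hx'
  have zB : ∀ x, F.Anc (s (b + 1)) x → ¬ F.Anc (s (c + 1)) x →
      x ∈ C.red ∪ C.blue ∧ (x ∈ C.red ↔ s c ∈ C.red) := fun x hx hx' =>
    hF.red_iff_of_between hH hU hs h0 hn (by omega) hcn (fun t ht ht' => kc t (by omega) ht') hx hx'
  have hint := fun {m : ℕ} (hm : m ≤ n) => run_mem_intervals (U := U) hs h0 hn hcol hm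
  have swap : ∀ F' : ElimForest H, F'.toRootedForest = h.swap → F'.width f ≤ F.width f →
      AdmitsNeutralSwap f C F U := fun F' hF' hw =>
    ⟨run C s n b, run C s n c, F', ⟨run C s n a, hint han.le, hint hbn.le, hint hcn.le,
      -- Only the first vertex of the fourth interval matters, so no colour change after `c` is
      -- needed.
      run C s n (c + 1), hint hcn, s a, s (a + 1), s b, s (b + 1), s c, s (c + 1),
      isLast_run hs ha, isFirst_run hs ha hlt kb, hs a han, isLast_run hs hb,
      isFirst_run hs hb hlt' kc, hs b hbn, isLast_run hs hc,
      isFirst_run hs hc (Nat.lt_succ_self c) (fun t h1 h2 => by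
        rw [show t = c + 1 by omega]), hs c hcn, hF' ▸ h.swap_edges⟩, hw⟩
  -- `P` is the colour of the upper path; the two cases differ by exchanging red and blue.
  by_cases hr : s b ∈ C.red
  · have hr' : s c ∉ C.red := fun h' => hbc_col (iff_of_true hr h')
    have hA : ∀ x, F.Anc (s (a + 1)) x → ¬ F.Anc (s (b + 1)) x → x ∈ C.red := fun x hx hx' =>
      (zA x hx hx').2.2 hr
    have hB : ∀ x, F.Anc (s (b + 1)) x → ¬ F.Anc (s (c + 1)) x → x ∈ C.blue := fun x hx hx' =>
      (zB x hx hx').1.resolve_left fun h' => hr' ((zB x hx hx').2.1 h')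
    have hPQ : ∀ x ∈ C.red, ∀ y ∈ C.blue, ¬ H.Adj x y := fun x hx y hy => C.adj_red_blue hx hy
    exact swap (h.swapElim hA hB hPQ) rfl (h.swapElim_width_le hA hB hPQ hf hH C.union_eq
      C.disjoint_red_blue C.disjoint_red_X C.disjoint_X_blue hN hab hbc hle hle')
  · have hr' : s c ∈ C.red := by
      by_contra h'
      exact hbc_col (iff_of_false hr h')
    have hA : ∀ x, F.Anc (s (a + 1)) x → ¬ F.Anc (s (b + 1)) x → x ∈ C.blue := fun x hx hx' =>
      (zA x hx hx').1.resolve_left fun h' => hr ((zA x hx hx').2.1 h')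
    have hB : ∀ x, F.Anc (s (b + 1)) x → ¬ F.Anc (s (c + 1)) x → x ∈ C.red := fun x hx hx' =>
      (zB x hx hx').2.2 hr'
    have hPQ : ∀ x ∈ C.blue, ∀ y ∈ C.red, ¬ H.Adj x y := fun x hx y hy h' =>
      C.adj_red_blue hy hx h'.symm
    have hV : C.blue ∪ C.X ∪ C.red = H.vertexSet := by
      rw [← C.union_eq, Set.union_comm, ← Set.union_assoc, Set.union_right_comm]
    exact swap (h.swapElim hA hB hPQ) rfl (h.swapElim_width_le hA hB hPQ hf hH hV
      C.disjoint_red_blue.symm C.disjoint_X_blue.symm C.disjoint_red_X.symm hN hab hbc hle hle')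

/-- An element of two cuts along a path lies in every cut between them. -/
theorem mem_cut_of_mem_of_mem (hs : F.IsPath s n) {i j k : ℕ} (hij : i ≤ j) (hjk : j ≤ k)
    (hk : k < n) {x : α} (hi : x ∈ F.cut (s i) (s (i + 1))) (hk' : x ∈ F.cut (s k) (s (k + 1))) :
    x ∈ F.cut (s j) (s (j + 1)) := by
  obtain ⟨h1, -⟩ := hi
  obtain ⟨-, w, h2, h3⟩ := hk'
  exact ⟨h1.trans (hs.anc hij (by omega)), w, (hs.anc (by omega) (by omega)).trans h2, h3⟩

/-- This cut is contained in the bag of the lower end `y` of the edge. -/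
theorem ncard_cut_le (hH : Proper H) {x y : α} (h : F.parent y = some x) (hN : (F.bag y).ncard ≤ N) :
    (F.cut x y).ncard ≤ N := by
  have hy := (F.mem_of_parent _ _ h).2
  rw [F.bag_eq_cut hH hy] at hN
  refine (Set.ncard_le_ncard ?_ (hH.finite.subset (F.cut_subset y y))).trans hN
  rintro v ⟨h1, h2⟩
  exact ⟨h1.of_parent h, h2⟩

end

/-- The number of colour intervals that guarantees a neutral swap, in terms of the number `x` of
uncoloured vertices, a bound `N` on the size of the bags, the rank and the maximum degree. -/
def intervalBound (x N r d : ℕ) : ℕ :=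
  (2 * (x * (1 + d * r) ^ (N + 1)) + 1) * (2 * typeCount N + 1)

theorem intervalBound_mono {x x' N N' r r' d d' : ℕ} (hx : x ≤ x') (hN : N ≤ N') (hr : r ≤ r')
    (hd : d ≤ d') : intervalBound x N r d ≤ intervalBound x' N' r' d' := by
  have h1 := typeCount_mono hN
  have h2 : (1 + d * r) ^ (N + 1) ≤ (1 + d' * r') ^ (N' + 1) :=
    (Nat.pow_le_pow_left (by gcongr) _).trans (Nat.pow_le_pow_right (by omega) (by omega))
  unfold intervalBound
  gcongr

theorem admitsNeutralSwap_of_intervalBound_lt {f : WidthFunction.{u}} (hf : WeaklyManageable f)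
    (hH : Proper H) {F : ElimForest H} (hF : F.Reduced) {N : ℕ}
    (hN : ∀ u ∈ H.vertexSet, (F.bag u).ncard ≤ N) (U : F.ContextFactor)
    (hU : U.carrier ⊆ C.red ∪ C.blue)
    (hlt : intervalBound C.X.ncard N (rank H) (maxDegree H) < (intervals C U).ncard) :
    AdmitsNeutralSwap f C F U := by
  obtain ⟨s, n, hs, h0, hn⟩ := U.anc_rt_pr.exists_isPath
  have hcol : ∀ m ≤ n, s m ∈ C.red ∪ C.blue := by
    intro m hm
    refine hU ⟨h0 ▸ hs.anc (Nat.zero_le m) hm, ?_⟩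
    simp only [Set.mem_iUnion, not_exists]
    intro w hw hwm
    exact RootedForest.Anc.not_of_parent (U.parent_appendices w hw)
      (RootedForest.Anc.trans hwm (hn ▸ hs.anc hm le_rfl))
  have hX : C.X ⊆ H.vertexSet := by
    rw [← C.union_eq]
    exact fun x hx => Or.inl (Or.inr hx)
  set D := ball H C.X (N + 1) with hD
  have hDfin : D.Finite := hH.finite.subset (ball_subset hX _)
  have hK := ncard_intervals_le hs h0 hn hcol
  obtain ⟨g, hg, hgm, hgs⟩ := (changes C s n).exists_enumeration
  set K := (changes C s n).card
  have hgn : ∀ j < K, g j < n := fun j hj => (mem_changes.1 (hg j hj)).1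
  have hgle : ∀ i j, i ≤ j → j < K → g i ≤ g j := fun i j hij hj => by
    rcases hij.lt_or_eq with h | rfl
    · exact (hgm i j h hj).le
    · exact le_rfl
  have hcut : ∀ j < K, (F.cut (s (g j)) (s (g j + 1))).ncard ≤ N := fun j hj =>
    ncard_cut_le hH (hs _ (hgn j hj)) (hN _ (F.mem_of_parent _ _ (hs _ (hgn j hj))).2)
  -- There is at most one interval more than there are changes, so `K` reaches `intervalBound`.
  -- Blocks of length $2T+1$, with $T$ the number of possible widths, are what the search for a
  -- local maximum needs.
  obtain ⟨j₀, hj₀, hconst⟩ := exists_constant_block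
    (Q := fun j => D ∩ F.cut (s (g j)) (s (g j + 1))) (L := 2 * typeCount N + 1) (K := K) hDfin
    (hH.ncard_ball_le hX (N + 1)) (by unfold intervalBound at hlt; omega)
    (fun _ => Set.inter_subset_left) (fun i j k hij hjk hk x hi hk' =>
      ⟨hi.1, mem_cut_of_mem_of_mem hs (hgle i j hij (by omega)) (hgle j k hjk hk) (hgn k hk)
        hi.2 hk'.2⟩)
  obtain ⟨hVfin, hVcard⟩ := hf.ncard_values_le hH N
  obtain ⟨j, hj1, hj2, hle, hle'⟩ := exists_local_max
    (a := fun j => f H (F.cut (s (g j)) (s (g j + 1)))) hVfin hVcard (j₀ := j₀) (fun j hj =>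
      ⟨_, F.cut_subset _ _, hcut j (by have := hj.2; omega), rfl⟩)
  have hno : ∀ i, i + 1 < K → ∀ t, g i < t → t < g (i + 1) → t ∉ changes C s n := by
    intro i hi t h1 h2 ht
    obtain ⟨l, hl, rfl⟩ := hgs t ht
    rcases Nat.lt_or_ge i l with h | h
    · exact absurd (hgle (i + 1) l h hl) (by omega)
    · exact absurd (hgle l i h (by omega)) (by omega)
  exact admitsNeutralSwap_of_local_max hf hH hF hU hs h0 hn hcol (hg j (by omega))
    (hg (j + 1) (by omega)) (hg (j + 2) (by omega)) (hgm _ _ (by omega) (by omega))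
    (hgm _ _ (by omega) (by omega)) (hno j (by omega)) (hno (j + 1) (by omega))
    (hcut (j + 1) (by omega)) (hconst j hj1 (by omega)) (hconst (j + 1) (by omega) (by omega))
    hle hle'

end HWidth

theorem mainTheorem4 (f : HWidth.WidthFunction.{u}) (hf : HWidth.WeaklyManageable f) :
    ∃ κ : ℕ × ℝ≥0 × ℕ × ℕ → ℕ, Monotone κ ∧
      ∀ ⦃α : Type u⦄ (H : Hypergraph α), HWidth.Proper H →
      ∀ (C : HWidth.ColourPartition H) (F : HWidth.ElimForest H),
        F.Reduced → F.width f = HWidth.fwidth f H →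
      ∀ U : F.ContextFactor, U.carrier ⊆ C.red ∪ C.blue →
        κ (C.X.ncard, HWidth.fwidth f H, HWidth.rank H, HWidth.maxDegree H)
          < (HWidth.intervals C U).ncard →
        HWidth.AdmitsNeutralSwap f C F U := by
  obtain ⟨β, hβ, hsize⟩ := hf.exists_monotone_bound
  -- The bag size $N$ is the monotone size bound at `fwidth f H` and `rank H`; it applies because
  -- `F` attains the minimum width.
  refine ⟨fun p => HWidth.intervalBound p.1 (β p.2.1 p.2.2.1) p.2.2.1 p.2.2.2, ?_, ?_⟩
  · rintro ⟨x, k, r, d⟩ ⟨x', k', r', d'⟩ ⟨hx, hk, hr, hd⟩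
    exact HWidth.intervalBound_mono hx (hβ _ _ _ _ hk hr) hr hd
  · intro α H hH C F hF hwidth U hU hlt
    refine HWidth.admitsNeutralSwap_of_intervalBound_lt hf hH hF (fun u hu => ?_) U hU hlt
    refine hsize _ H hH _ ?_ (hwidth ▸ F.le_width hH f hu)
    rw [F.bag_eq_cut hH hu]
    exact F.cut_subset u u
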